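/- Let $\overline{\mathbb R}=(\mathbb R,+,\cdot,(r)_{r\in\mathbb R})$ be the field of real numbers with a constant for every real number, and let $\mathbb R_{\mathrm{an}}$ be its expansion by all restricted analytic functions, i.e. by all functions $\mathbb R^n\to\mathbb R$ ($n\in\mathbb N$) that vanish off $[-1,1]^n$ and agree on $[-1,1]^n$ with a function that is real analytic in a neighbourhood of $[-1,1]^n$. A structure defines a set $X\subseteq\mathbb R^n$ if $X$ is given by a first-order formula in its language; it defines a (partial) function if it defines its graph, and expanding a structure by a (partial) function means adding its graph as a relation. For $s>1$ put \[F_s(x)=\prod_{n\ge 1}\bigl(1+s^{-n}x\bigr),\qquad x\in\mathbb R.\] For $c\in\mathbb R$ let $F_s'/F_s{\restriction}(c,\infty)$ and $(xF_s'/F_s)'{\restriction}(c,\infty)$ denote the restrictions of these functions to the set of all $x>c$ with $F_s(x)\neq 0$. Let $s>1$ and $c\in\mathbb R$. Then: 1. $\bigl(\overline{\mathbb R},\,F_s'/F_s{\restriction}(c,\infty)\bigr)$ defines $\mathbb Z$. 2. $\bigl(\overline{\mathbb R},\,(xF_s'/F_s)'{\restriction}(c,\infty)\bigr)$ defines $s^{\mathbb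 Z}=\{s^k:k\in\mathbb Z\}$. 3. If $r>0$ is irrational, then $\bigl(\overline{\mathbb R},\,(xF_s'/F_s)'{\restriction}(c,\infty),\,(xF_{s^r}'/F_{s^r})'{\restriction}(c,\infty)\bigr)$ defines $\mathbb Z$. 4. For every rational $q>0$, $(\mathbb R_{\mathrm{an}},s^{\mathbb Z})$ defines $(xF_{s^q}'/F_{s^q})'{\restriction}(c,\infty)$. -/

import Mathlib

open FirstOrder

/-- A subset of some finite Cartesian power `ℝⁿ`. -/
abbrev RealSet : Type := Σ n : ℕ, Set (Fin n → ℝ)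

/-- The language with one `n`-ary relation symbol for each `X ⊆ ℝⁿ` in the family `S`. -/
def relLanguage (S : Set RealSet) : Language where
  Functions _ := Empty
  Relations n := {X : Set (Fin n → ℝ) // (⟨n, X⟩ : RealSet) ∈ S}

/-- Each relation symbol is interpreted as the set that it names. -/
instance relLanguageStructure (S : Set RealSet) : (relLanguage S).Structure ℝ where
  funMap f _ := f.elim
  RelMap R v := v ∈ R.1

/-- The field operations of `ℝ`, as an interpretation of the language of rings. -/
noncomputable instance realCompatibleRing : FirstOrder.Ring.CompatibleRing ℝ :=
  FirstOrder.Ring.compatibleRingOfRing ℝ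

/-- The structure `(ℝ, +, ·, (r)_{r ∈ ℝ}, (X)_{X ∈ S})`, that is, the expansion of the real field
with constants by the sets in `S`, defines the set `X`. The constants for all real numbers are
present as parameters from `Set.univ`. -/
def Defines (S : Set RealSet) (X : RealSet) : Prop :=
  (Set.univ : Set ℝ).Definable (Language.ring.sum (relLanguage S)) X.2

/-- A set of real numbers, as a subset of `ℝ¹`. -/
def unarySet (A : Set ℝ) : RealSet := ⟨1, {v | v 0 ∈ A}⟩

/-- The graph of the restriction of `f` to `D`, as a subset of `ℝ²`. -/
def restrictedGraph (f : ℝ → ℝ) (D : Set ℝ) : RealSet := ⟨2, {v | v 0 ∈ D ∧ v 1 = f (v 0)}⟩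

/-- The primitives of `ℝ_an`: the graphs of all functions `ℝⁿ → ℝ` that vanish off the cube
`[-1, 1]ⁿ` and agree on it with a function that is real analytic in a neighbourhood of it. -/
def restrictedAnalytic : Set RealSet :=
  {X | ∃ (n : ℕ) (f : (Fin n → ℝ) → ℝ), AnalyticOnNhd ℝ f (Set.Icc (-1) 1) ∧
    X = ⟨n + 1, {v | v (Fin.last n) = (Set.Icc (-1) 1).indicator f (Fin.init v)}⟩}

/-- The set `ℤ` of integers, as a set of real numbers. -/
def integers : RealSet := unarySet (Set.range (fun k : ℤ => (k : ℝ)))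

/-- The set `s^ℤ` of integer powers of `s`. -/
noncomputable def integerPowers (s : ℝ) : RealSet := unarySet (Set.range (fun k : ℤ => s ^ k))

/-- The canonical product `F_s(x) = ∏_{n ≥ 1} (1 + s⁻ⁿ x)`, on the real line. -/
noncomputable def eulerProduct (s x : ℝ) : ℝ := ∏' n : ℕ, (1 + (s ^ (n + 1))⁻¹ * x)

/-- The points of `(c, ∞)` that are not zeros of `F_s`, that is, not poles of `F_s' / F_s`. -/
def rayOffPoles (s c : ℝ) : Set ℝ := {x | c < x ∧ eulerProduct s x ≠ 0}

/-- The logarithmic derivative `F_s' / F_s`. -/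
noncomputable def eulerLogDeriv (s x : ℝ) : ℝ := deriv (eulerProduct s) x / eulerProduct s x

/-- The restriction of `F_s' / F_s` to `(c, ∞)` (where it is defined). -/
noncomputable def logDerivGraph (s c : ℝ) : RealSet :=
  restrictedGraph (eulerLogDeriv s) (rayOffPoles s c)

/-- The restriction of `(x F_s' / F_s)'` to `(c, ∞)` (where it is defined). -/
noncomputable def derivMulLogDerivGraph (s c : ℝ) : RealSet :=
  restrictedGraph (deriv (fun x => x * eulerLogDeriv s x)) (rayOffPoles s c)

/-!
Write `M(x) = x F_s'(x) / F_s(x)`. Everything rests on the functional equation `F_s(sx) = (1 + x)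
F_s(x)` and its consequences `M(sx) = M(x) + x / (1 + x)` and `s M'(sx) = M'(x) + 1 / (1 + x)²`.

**Behaviour at infinity.** With `a = log s`, the functional equation for `M` shows that `θ(u) =
M(e^u) - M(e^{-u}) - 1 / (1 + e^u)` satisfies `θ(u + a) = θ(u) + 1`, so that its derivative `τ(u)
= e^u M'(e^u) + e^{-u} M'(e^{-u}) + e^u / (1 + e^u)²` has period `a`. Moreover `M(e^u) - θ(u)` and
`e^u M'(e^u) - τ(u)` tend to zero for `u → ∞`. Hence `M(xy) - M(x)` converges to `d` for `x → ∞`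
if and only if `θ(u + log y) = θ(u) + d` for all `u`, and `xy M'(xy) - x M'(x)` tends to zero if
and only if `log y` is a period of `τ` (`tendsto_mul_sub_iff`). The function `τ` is not constant,
because its analytic continuation has a pole at `u = π i` (`periodicPart_not_const`); so its
periods are the multiples of `a / m` for some `m ≥ 1`. The numbers `y` that occur are therefore
the powers of `s^{1/m}`, and the limits `d` the multiples of `1 / m`. Raising to the power `m`, or
multiplying by `m`, one gets `s^ℤ` from `M'` and `ℤ` from `F_s' / F_s`.

**Two groups of powers.** For irrational `r` put `t = s^r` and `x_n = s^{fract (rn)}`, the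
quotient of `tⁿ` by the greatest power of `s` that does not exceed it. The sequence `x_n` is dense
in `[1, s]`, and `x_{n+i}` is bounded away from `x_n`, uniformly in `n`. A nested interval
argument produces a real number `c` such that the limit points greater than `1` of `1 / (tⁿ (c -
x_n))` are precisely the integers greater than `1` (`exists_coding_integers`). The step of the
construction has to keep `c` out of `[x_l, x_l + t⁻ˡ]` for all indices `l` passed over; that there
is room for this is a comparison of lengths (`eventually_exists_close_pair_avoiding`). The limit
points are definable from `s^ℤ` and `t^ℤ`.

**The converse.** The powers of `s^q` with `q` rational are semialgebraic in the powers of `s`.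
The function `M'` is analytic near `[-1, 1]`. The periodicity of `τ` expresses `M'(x)` for `x > 1`
by values on `[0, 1]` and the power `p` of `s` with `p ≤ x < sp` (`mul_derivMulLogDeriv_eq`), and
the functional equation extends definability from `(c, ∞)` to `(sc, ∞)`.
-/

/-! ### Definable relations and functions -/

/-- The relation `P` between real numbers indexed by `α` is definable in the expansion of the real
field, with all constants, by the sets in `S`. -/
def DefRel (S : Set RealSet) {α : Type} (P : (α → ℝ) → Prop) : Prop :=
  (Set.univ : Set ℝ).Definable (Language.ring.sum (relLanguage S)) {v | P v}

/-- The function `f` is definable in the expansion of the real field, with all constants, by the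
sets in `S`. -/
def DefFun (S : Set RealSet) {α : Type} (f : (α → ℝ) → ℝ) : Prop :=
  (Set.univ : Set ℝ).DefinableFun (Language.ring.sum (relLanguage S)) f

namespace DefRel

variable {S : Set RealSet} {α : Type}

theorem congr {P Q : (α → ℝ) → Prop} (hP : DefRel S P) (h : ∀ v, Q v ↔ P v) : DefRel S Q := by
  rwa [show Q = P from funext fun v => propext (h v)]

theorem and {P Q : (α → ℝ) → Prop} (hP : DefRel S P) (hQ : DefRel S Q) :
    DefRel S fun v => P v ∧ Q v :=
  Set.Definable.inter hP hQ

theorem or {P Q : (α → ℝ) → Prop} (hP : DefRel S P) (hQ : DefRel S Q) :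
    DefRel S fun v => P v ∨ Q v :=
  Set.Definable.union hP hQ

theorem not {P : (α → ℝ) → Prop} (hP : DefRel S P) : DefRel S fun v => ¬ P v :=
  Set.Definable.compl hP

theorem imp {P Q : (α → ℝ) → Prop} (hP : DefRel S P) (hQ : DefRel S Q) :
    DefRel S fun v => P v → Q v :=
  (hP.not.or hQ).congr fun _ => imp_iff_not_or

/-- Quantification over a real number; the context of the body has one more variable `none`. -/
theorem ex {P : (α → ℝ) → ℝ → Prop}
    (hP : DefRel S fun w : Option α → ℝ => P (fun i => w (some i)) (w none)) :
    DefRel S fun v => ∃ x, P v x := by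
  have h1 : (Set.univ : Set ℝ).Definable (Language.ring.sum (relLanguage S))
      {w : α ⊕ Unit → ℝ | P (fun i => w (Sum.inl i)) (w (Sum.inr ()))} :=
    hP.preimage_comp fun o : Option α => o.elim (Sum.inr ()) Sum.inl
  refine DefRel.congr (P := fun v => ∃ u : Unit → ℝ, P v (u ())) h1.exists_of_finite fun v => ?_
  exact ⟨fun ⟨x, hx⟩ => ⟨fun _ => x, hx⟩, fun ⟨u, hu⟩ => ⟨u (), hu⟩⟩

theorem all {P : (α → ℝ) → ℝ → Prop}
    (hP : DefRel S fun w : Option α → ℝ => P (fun i => w (some i)) (w none)) :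
    DefRel S fun v => ∀ x, P v x :=
  (ex (P := fun v x => ¬ P v x) hP.not).not.congr fun v => by simp

theorem eq {f g : (α → ℝ) → ℝ} (hf : DefFun S f) (hg : DefFun S g) :
    DefRel S fun v => f v = g v :=
  Set.DefinableFun.ofPred_eq hf hg

end DefRel

section

variable {S : Set RealSet} {α : Type}

theorem DefFun.var (i : α) : DefFun S fun v : α → ℝ => v i :=
  Set.DefinableFun.proj _

theorem DefFun.const (r : ℝ) : DefFun S fun _ : α → ℝ => r :=
  Language.definableFun_const _ α (Set.mem_univ r)

/-- Substitution of definable functions for the variables of a definable relation. -/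
theorem Defines.subst {n : ℕ} {R : Set (Fin n → ℝ)} (hR : Defines S ⟨n, R⟩)
    {F : (α → ℝ) → Fin n → ℝ} (hF : ∀ i, DefFun S fun v => F v i) :
    DefRel S fun v => F v ∈ R :=
  Set.Definable.preimage_map (F := F) hF hR

/-- A function with a definable graph is definable, and stays so under substitution. -/
theorem DefFun.of_graph {f : ℝ → ℝ} {g : (α → ℝ) → ℝ} (hg : DefFun S g)
    (h : DefRel S fun v : Fin 2 → ℝ => v 1 = f (v 0)) : DefFun S fun v => f (g v) := by
  refine Set.DefinableFun.comp (f := fun w : Fin 1 → ℝ => f (w 0)) (g := fun v _ => g v)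
    (fun _ => hg) ?_
  have := Set.Definable.preimage_comp
    (fun i : Fin 2 => if i = 0 then (some 0 : Option (Fin 1)) else none) h
  refine DefRel.congr this fun v => ?_
  simp [eq_comm]

theorem DefFun.of_graph₂ {f : ℝ → ℝ → ℝ} {g₁ g₂ : (α → ℝ) → ℝ} (h₁ : DefFun S g₁)
    (h₂ : DefFun S g₂) (h : DefRel S fun v : Fin 3 → ℝ => v 2 = f (v 0) (v 1)) :
    DefFun S fun v => f (g₁ v) (g₂ v) := by
  refine Set.DefinableFun.comp (f := fun w : Fin 2 → ℝ => f (w 0) (w 1))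
    (g := fun v => ![g₁ v, g₂ v]) (fun i => ?_) ?_
  · fin_cases i
    exacts [h₁, h₂]
  have := Set.Definable.preimage_comp
    (fun i : Fin 3 => if i = 0 then (some 0 : Option (Fin 2)) else if i = 1 then some 1 else none) h
  refine DefRel.congr this fun v => ?_
  simp [eq_comm]

/-- A set definable in the ring language is definable in the expansion. -/
theorem DefRel.of_ring {P : (α → ℝ) → Prop} (φ : Language.ring.Formula α)
    (h : ∀ v, P v ↔ φ.Realize v) : DefRel S P := by
  have h1 : (∅ : Set ℝ).Definable Language.ring {v | P v} :=
    Set.empty_definable_iff.2 ⟨φ, Set.ext h⟩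
  exact (h1.map_expansion (Language.LHom.sumInl :
    Language.ring →ᴸ Language.ring.sum (relLanguage S))).mono (Set.empty_subset _)

theorem DefFun.add {f g : (α → ℝ) → ℝ} (hf : DefFun S f) (hg : DefFun S g) :
    DefFun S fun v => f v + g v :=
  hf.of_graph₂ hg <| DefRel.of_ring ((Language.Term.var 2).equal
    (Language.Term.var 0 + Language.Term.var 1)) fun v => by
      simp [Language.Formula.realize_equal]

theorem DefFun.mul {f g : (α → ℝ) → ℝ} (hf : DefFun S f) (hg : DefFun S g) :
    DefFun S fun v => f v * g v :=
  hf.of_graph₂ hg <| DefRel.of_ring ((Language.Term.var 2).equal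
    (Language.Term.var 0 * Language.Term.var 1)) fun v => by
      simp [Language.Formula.realize_equal]

theorem DefFun.neg {f : (α → ℝ) → ℝ} (hf : DefFun S f) : DefFun S fun v => -f v := by
  simpa using (DefFun.const (-1)).mul hf

theorem DefFun.sub {f g : (α → ℝ) → ℝ} (hf : DefFun S f) (hg : DefFun S g) :
    DefFun S fun v => f v - g v := by
  simpa [sub_eq_add_neg] using hf.add hg.neg

theorem DefFun.pow {f : (α → ℝ) → ℝ} (hf : DefFun S f) (n : ℕ) : DefFun S fun v => f v ^ n := by
  induction n with
  | zero => simpa using DefFun.const 1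
  | succ n ih => simpa [pow_succ] using ih.mul hf

theorem DefFun.inv {f : (α → ℝ) → ℝ} (hf : DefFun S f) : DefFun S fun v => (f v)⁻¹ := by
  refine hf.of_graph (f := fun x => x⁻¹) ?_
  refine DefRel.congr (P := fun v : Fin 2 → ℝ => v 0 * v 1 * v 0 = v 0 ∧ v 1 * v 0 * v 1 = v 1)
    (.and (.eq (.mul (.mul (.var _) (.var _)) (.var _)) (.var _))
      (.eq (.mul (.mul (.var _) (.var _)) (.var _)) (.var _))) fun v => ?_
  constructor
  · intro h
    rw [h]
    by_cases h0 : v 0 = 0 <;> simp [h0]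
  · rintro ⟨h1, h2⟩
    by_cases h0 : v 0 = 0
    · rw [← h2, h0]
      simp
    · exact eq_inv_of_mul_eq_one_left (mul_right_cancel₀ h0 (by linear_combination h1))

theorem DefFun.div {f g : (α → ℝ) → ℝ} (hf : DefFun S f) (hg : DefFun S g) :
    DefFun S fun v => f v / g v := by
  simpa [div_eq_mul_inv] using hf.mul hg.inv

theorem DefRel.lt {f g : (α → ℝ) → ℝ} (hf : DefFun S f) (hg : DefFun S g) :
    DefRel S fun v => f v < g v := by
  have key : DefRel S fun v : Fin 2 → ℝ => v 0 < v 1 := by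
    refine DefRel.congr (P := fun v : Fin 2 → ℝ => ∃ z, v 0 + z ^ 2 = v 1 ∧ ¬ z = 0)
      (.ex (.and (.eq (.add (.var _) (.pow (.var _) 2)) (.var _))
        (.not (.eq (.var _) (.const 0))))) fun v => ?_
    constructor
    · intro h
      exact ⟨√(v 1 - v 0), by rw [Real.sq_sqrt (by linarith)]; ring,
        (Real.sqrt_pos.2 (by linarith)).ne'⟩
    · rintro ⟨z, hz, h0⟩
      have : 0 < z ^ 2 := by positivity
      linarith
  refine Defines.subst (R := {v : Fin 2 → ℝ | v 0 < v 1}) (F := fun v => ![f v, g v]) key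
    fun i => ?_
  fin_cases i
  exacts [hf, hg]

theorem DefRel.le {f g : (α → ℝ) → ℝ} (hf : DefFun S f) (hg : DefFun S g) :
    DefRel S fun v => f v ≤ g v :=
  (DefRel.lt hg hf).not.congr fun _ => not_lt.symm

theorem DefRel.abs_lt {f g : (α → ℝ) → ℝ} (hf : DefFun S f) (hg : DefFun S g) :
    DefRel S fun v => |f v| < g v :=
  (DefRel.and (.lt (.neg hg) hf) (.lt hf hg)).congr fun _ => _root_.abs_lt

theorem Defines.of_mem {X : RealSet} (h : X ∈ S) : Defines S X := by
  obtain ⟨n, X⟩ := X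
  have h1 : (∅ : Set ℝ).Definable (relLanguage S) X := by
    let R : (relLanguage S).Relations n := ⟨X, h⟩
    refine Set.empty_definable_iff.2 ⟨R.formula fun i => Language.Term.var i, ?_⟩
    ext v
    rw [Set.mem_ofPred_eq, Language.Formula.realize_rel]
    exact Iff.rfl
  exact (h1.map_expansion (Language.LHom.sumInr :
    relLanguage S →ᴸ Language.ring.sum (relLanguage S))).mono (Set.empty_subset _)

theorem Defines.mem_unary {A : Set ℝ} (hA : Defines S (unarySet A)) {f : (α → ℝ) → ℝ}
    (hf : DefFun S f) : DefRel S fun v => f v ∈ A :=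
  Defines.subst hA (F := fun v _ => f v) fun _ => hf

theorem Defines.mem_graph {h : ℝ → ℝ} {D : Set ℝ} (hh : Defines S (restrictedGraph h D))
    {f g : (α → ℝ) → ℝ} (hf : DefFun S f) (hg : DefFun S g) :
    DefRel S fun v => f v ∈ D ∧ g v = h (f v) := by
  refine Defines.subst hh (F := fun v => ![f v, g v]) fun i => ?_
  fin_cases i
  exacts [hf, hg]

end

/-! ### The canonical product and its logarithmic derivative -/

/-- The canonical product `∏_{n ≥ 1} (1 + s⁻ⁿ z)` as an entire function of `z`. -/
noncomputable def complexEulerProduct (s : ℝ) (z : ℂ) : ℂ :=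
  ∏' n : ℕ, (1 + ((s : ℂ) ^ (n + 1))⁻¹ * z)

section

variable {s : ℝ}

theorem summable_inv_pow_succ (hs : 1 < s) : Summable fun n : ℕ => (s ^ (n + 1))⁻¹ := by
  have h : Summable fun n : ℕ => (s⁻¹) ^ (n + 1) :=
    (summable_nat_add_iff 1).2
      (summable_geometric_of_lt_one (by positivity) (inv_lt_one_of_one_lt₀ hs))
  simpa using h

theorem summable_norm_eulerFactor (hs : 1 < s) (z : ℂ) :
    Summable fun n : ℕ => ‖((s : ℂ) ^ (n + 1))⁻¹ * z‖ := by
  have h := (summable_inv_pow_succ hs).mul_right ‖z‖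
  refine h.congr fun n => ?_
  rw [norm_mul, norm_inv, norm_pow, Complex.norm_real, Real.norm_of_nonneg (by linarith)]

theorem multipliable_eulerFactor (hs : 1 < s) (z : ℂ) :
    Multipliable fun n : ℕ => 1 + ((s : ℂ) ^ (n + 1))⁻¹ * z :=
  multipliable_one_add_of_summable (summable_norm_eulerFactor hs z)

theorem differentiable_complexEulerProduct (hs : 1 < s) :
    Differentiable ℂ (complexEulerProduct s) := by
  intro z₀
  have hu := (summable_inv_pow_succ hs).mul_right (‖z₀‖ + 1)
  have hop : IsOpen (Metric.ball (0 : ℂ) (‖z₀‖ + 1)) := Metric.isOpen_ball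
  have h := hu.hasProdLocallyUniformlyOn_one_add (f := fun (n : ℕ) (z : ℂ) =>
      ((s : ℂ) ^ (n + 1))⁻¹ * z) hop
    (.of_forall fun n z hz => by
      rw [norm_mul, norm_inv, norm_pow, Complex.norm_real, Real.norm_of_nonneg (by linarith)]
      gcongr
      exact (mem_ball_zero_iff.1 hz).le) (fun n => by fun_prop)
  have h2 : DifferentiableOn ℂ (complexEulerProduct s) (Metric.ball (0 : ℂ) (‖z₀‖ + 1)) :=
    h.differentiableOn (.of_forall fun _ => by
      simpa [Finset.prod_fn] using DifferentiableOn.finsetProd (fun _ _ => by fun_prop)) hop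
  exact h2.differentiableAt (hop.mem_nhds (by simp))

theorem complexEulerProduct_ne_zero (hs : 1 < s) {z : ℂ} (hz : ‖z‖ < s) :
    complexEulerProduct s z ≠ 0 := by
  refine tprod_one_add_ne_zero_of_summable (fun n h0 => ?_) (summable_norm_eulerFactor hs z)
  have hn : ‖((s : ℂ) ^ (n + 1))⁻¹ * z‖ < 1 := by
    rw [norm_mul, norm_inv, norm_pow, Complex.norm_real, Real.norm_of_nonneg (by linarith),
      inv_mul_lt_iff₀ (by positivity), mul_one]
    exact hz.trans_le (le_self_pow₀ hs.le (by simp))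
  rw [eq_neg_of_add_eq_zero_right h0] at hn
  simp at hn

theorem complexEulerProduct_ofReal (hs : 1 < s) (x : ℝ) :
    complexEulerProduct s x = (eulerProduct s x : ℂ) := by
  have hm : Multipliable fun n : ℕ => 1 + (s ^ (n + 1))⁻¹ * x :=
    multipliable_one_add_of_summable <| by
      refine (summable_norm_eulerFactor hs x).congr fun n => ?_
      rw [← Complex.norm_real]
      simp
  have h := hm.map_tprod (Complex.ofRealHom : ℝ →* ℂ) Complex.continuous_ofReal
  simpa [complexEulerProduct, eulerProduct] using h.symm

theorem complexEulerProduct_mul (hs : 1 < s) (z : ℂ) :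
    complexEulerProduct s (s * z) = (1 + z) * complexEulerProduct s z := by
  have h0 : (s : ℂ) ≠ 0 := by
    exact_mod_cast (by linarith : s ≠ 0)
  have hshift : ∀ n : ℕ, ((s : ℂ) ^ (n + 1 + 1))⁻¹ * (s * z) = ((s : ℂ) ^ (n + 1))⁻¹ * z := by
    intro n
    field_simp
    ring
  rw [complexEulerProduct, tprod_eq_zero_mul'
    ((multipliable_eulerFactor hs z).congr fun n => by rw [hshift])]
  simp only [hshift]
  simp [complexEulerProduct, h0]

theorem eulerProduct_mul (hs : 1 < s) (x : ℝ) :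
    eulerProduct s (s * x) = (1 + x) * eulerProduct s x := by
  have h := complexEulerProduct_mul hs x
  rw [← Complex.ofReal_mul, complexEulerProduct_ofReal hs, complexEulerProduct_ofReal hs] at h
  exact_mod_cast h

theorem eulerProduct_ne_zero_of_abs_lt (hs : 1 < s) {x : ℝ} (hx : |x| < s) :
    eulerProduct s x ≠ 0 := by
  have h := complexEulerProduct_ne_zero hs (z := x) (by simpa using hx)
  rw [complexEulerProduct_ofReal hs] at h
  exact_mod_cast h

theorem analyticAt_eulerProduct (hs : 1 < s) (x : ℝ) : AnalyticAt ℝ (eulerProduct s) x := by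
  have h1 : AnalyticAt ℂ (complexEulerProduct s) x :=
    (differentiable_complexEulerProduct hs).analyticAt _
  have h2 := h1.re_ofReal
  refine h2.congr (.of_forall fun y => ?_)
  simp [complexEulerProduct_ofReal hs]

theorem eulerProduct_ne_zero_of_neg_one_lt (hs : 1 < s) {x : ℝ} (hx : -1 < x) :
    eulerProduct s x ≠ 0 := by
  -- Dividing `x` by powers of `s` brings it into the disc on which no factor vanishes.
  have key : ∀ n : ℕ, ∀ x : ℝ, -1 < x → x < s ^ (n + 1) → eulerProduct s x ≠ 0 := by
    intro n
    induction n with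
    | zero =>
      intro x h1 h2
      refine eulerProduct_ne_zero_of_abs_lt hs (abs_lt.2 ⟨by linarith, by simpa using h2⟩)
    | succ n ih =>
      intro x h1 h2
      have h3 : -1 < x / s := by
        rw [lt_div_iff₀ (by linarith)]
        linarith
      have h4 : x / s < s ^ (n + 1) := by
        rw [div_lt_iff₀ (by linarith), ← pow_succ]
        exact h2
      have h5 := eulerProduct_mul hs (x / s)
      rw [mul_div_cancel₀ _ (by linarith : s ≠ 0)] at h5
      rw [h5]
      exact mul_ne_zero (by linarith) (ih _ h3 h4)
  obtain ⟨n, hn⟩ := pow_unbounded_of_one_lt x hs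
  exact key n x hx (hn.trans (pow_lt_pow_right₀ hs (Nat.lt_succ_self n)))

/-- The function `x F_s'(x) / F_s(x)`. -/
noncomputable def mulLogDeriv (s x : ℝ) : ℝ := x * eulerLogDeriv s x

/-- The function `(x F_s'(x) / F_s(x))'`. -/
noncomputable def derivMulLogDeriv (s : ℝ) : ℝ → ℝ := deriv (mulLogDeriv s)

theorem analyticAt_mulLogDeriv (hs : 1 < s) {x : ℝ} (hx : eulerProduct s x ≠ 0) :
    AnalyticAt ℝ (mulLogDeriv s) x := by
  have h := analyticAt_eulerProduct hs x
  exact analyticAt_id.mul (h.deriv.div h hx)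

theorem analyticAt_derivMulLogDeriv (hs : 1 < s) {x : ℝ} (hx : eulerProduct s x ≠ 0) :
    AnalyticAt ℝ (derivMulLogDeriv s) x :=
  (analyticAt_mulLogDeriv hs hx).deriv

theorem hasDerivAt_mulLogDeriv (hs : 1 < s) {x : ℝ} (hx : eulerProduct s x ≠ 0) :
    HasDerivAt (mulLogDeriv s) (derivMulLogDeriv s x) x :=
  (analyticAt_mulLogDeriv hs hx).differentiableAt.hasDerivAt

theorem mulLogDeriv_mul (hs : 1 < s) {x : ℝ} (hx : eulerProduct s (s * x) ≠ 0) :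
    mulLogDeriv s (s * x) = mulLogDeriv s x + x / (1 + x) := by
  have h0 := hx
  rw [eulerProduct_mul hs, mul_ne_zero_iff] at h0
  have hd := fun y => (analyticAt_eulerProduct hs y).differentiableAt.hasDerivAt
  have h1 : HasDerivAt (fun y => eulerProduct s (s * y)) (deriv (eulerProduct s) (s * x) * s) x :=
    (hd (s * x)).comp x (by simpa using (hasDerivAt_id x).const_mul s)
  have h2 : HasDerivAt (fun y => (1 + y) * eulerProduct s y)
      (1 * eulerProduct s x + (1 + x) * deriv (eulerProduct s) x) x :=
    ((hasDerivAt_id x).const_add 1).mul (hd x)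
  rw [← funext (eulerProduct_mul hs)] at h2
  have h3 := h1.unique h2
  rw [mulLogDeriv, mulLogDeriv, eulerLogDeriv, eulerLogDeriv, eulerProduct_mul hs]
  have h4 := h0.1
  have h5 := h0.2
  field_simp
  linear_combination x * h3

theorem derivMulLogDeriv_mul (hs : 1 < s) {x : ℝ} (hx : eulerProduct s (s * x) ≠ 0) :
    s * derivMulLogDeriv s (s * x) = derivMulLogDeriv s x + 1 / (1 + x) ^ 2 := by
  have h0 := hx
  rw [eulerProduct_mul hs, mul_ne_zero_iff] at h0
  have h1 : HasDerivAt (fun y => mulLogDeriv s (s * y)) (derivMulLogDeriv s (s * x) * s) x :=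
    (hasDerivAt_mulLogDeriv hs hx).comp x (by simpa using (hasDerivAt_id x).const_mul s)
  have h2 : HasDerivAt (fun y => mulLogDeriv s y + y / (1 + y))
      (derivMulLogDeriv s x + (1 * (1 + x) - x * 1) / (1 + x) ^ 2) x :=
    (hasDerivAt_mulLogDeriv hs h0.2).add
      ((hasDerivAt_id x).div ((hasDerivAt_id x).const_add 1) h0.1)
  have h3 : ∀ᶠ y in nhds x, eulerProduct s (s * y) ≠ 0 := by
    have hc : ContinuousAt (fun y => eulerProduct s (s * y)) x :=
      (analyticAt_eulerProduct hs (s * x)).continuousAt.comp (f := fun y => s * y) (by fun_prop)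
    exact hc.eventually_ne hx
  have h4 := h1.unique (h2.congr_of_eventuallyEq (h3.mono fun y hy => mulLogDeriv_mul hs hy))
  rw [mul_comm, h4]
  ring

end

/-! ### The periodic part, and its periods -/

open Filter Topology in
/-- A complex function that is real on the real axis has there the derivative of its
restriction. -/
theorem deriv_ofReal_eq {g : ℂ → ℂ} {f : ℝ → ℝ} {x : ℝ} (hg : DifferentiableAt ℂ g x)
    (hf : DifferentiableAt ℝ f x) (h : ∀ᶠ y : ℝ in 𝓝 x, g y = f y) :
    deriv g x = (deriv f x : ℝ) := by
  have h1 := hg.hasDerivAt.comp_ofReal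
  have h2 := hf.hasDerivAt.ofReal_comp
  exact h1.unique (h2.congr_of_eventuallyEq h)

section

variable {s : ℝ}

/-- The function `u ↦ e^u (x F'/F)'(e^u)`, made exactly periodic with period `log s` by terms that
tend to zero at infinity. -/
noncomputable def periodicPart (s u : ℝ) : ℝ :=
  Real.exp u * derivMulLogDeriv s (Real.exp u) +
    Real.exp (-u) * derivMulLogDeriv s (Real.exp (-u)) + Real.exp u / (1 + Real.exp u) ^ 2

/-- The function `u ↦ e^u F'(e^u) / F(e^u)`, corrected by terms that tend to zero at infinity so
that it increases by exactly `1` over each interval of length `log s`. -/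
noncomputable def quasiperiodicPart (s u : ℝ) : ℝ :=
  mulLogDeriv s (Real.exp u) - mulLogDeriv s (Real.exp (-u)) - 1 / (1 + Real.exp u)

theorem eulerProduct_exp_ne_zero (hs : 1 < s) (u : ℝ) : eulerProduct s (Real.exp u) ≠ 0 :=
  eulerProduct_ne_zero_of_neg_one_lt hs (by linarith [Real.exp_pos u])

theorem exp_add_log (hs : 1 < s) (u : ℝ) : Real.exp (u + Real.log s) = s * Real.exp u := by
  rw [Real.exp_add, Real.exp_log (by linarith), mul_comm]

theorem mul_exp_neg_add_log (hs : 1 < s) (u : ℝ) :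
    s * Real.exp (-(u + Real.log s)) = Real.exp (-u) := by
  rw [← exp_add_log hs]
  congr 1
  ring

theorem periodicPart_add_log (hs : 1 < s) (u : ℝ) :
    periodicPart s (u + Real.log s) = periodicPart s u := by
  have h1 := derivMulLogDeriv_mul hs (x := Real.exp u)
    (by rw [← exp_add_log hs]; exact eulerProduct_exp_ne_zero hs _)
  have h2 := derivMulLogDeriv_mul hs (x := Real.exp (-(u + Real.log s)))
    (by rw [mul_exp_neg_add_log hs]; exact eulerProduct_exp_ne_zero hs _)
  rw [mul_exp_neg_add_log hs] at h2
  have h3 : Real.exp (-(u + Real.log s)) = (s * Real.exp u)⁻¹ := by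
    rw [Real.exp_neg, exp_add_log hs]
  have h4 : Real.exp (-u) = (Real.exp u)⁻¹ := Real.exp_neg u
  rw [periodicPart, periodicPart, exp_add_log hs]
  rw [h3, h4] at h2
  rw [h3, h4]
  clear h3 h4
  have hp := Real.exp_pos u
  generalize Real.exp u = x at *
  have hs0 : 0 < s := by linarith
  have e1 : s * x * derivMulLogDeriv s (s * x) = x * (derivMulLogDeriv s x + 1 / (1 + x) ^ 2) := by
    rw [← h1]
    ring
  have e2 : (s * x)⁻¹ * derivMulLogDeriv s (s * x)⁻¹ =
      x⁻¹ * derivMulLogDeriv s x⁻¹ - (s * x)⁻¹ * (1 / (1 + (s * x)⁻¹) ^ 2) := by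
    have : (s * x)⁻¹ * s = x⁻¹ := by field_simp
    linear_combination (s * x)⁻¹ * (-h2) + this * derivMulLogDeriv s x⁻¹
  have e3 : (s * x)⁻¹ * (1 / (1 + (s * x)⁻¹) ^ 2) = s * x / (1 + s * x) ^ 2 := by
    field_simp
    ring
  rw [e1, e2, e3]
  ring

theorem quasiperiodicPart_add_log (hs : 1 < s) (u : ℝ) :
    quasiperiodicPart s (u + Real.log s) = quasiperiodicPart s u + 1 := by
  have h1 := mulLogDeriv_mul hs (x := Real.exp u)
    (by rw [← exp_add_log hs]; exact eulerProduct_exp_ne_zero hs _)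
  have h2 := mulLogDeriv_mul hs (x := Real.exp (-(u + Real.log s)))
    (by rw [mul_exp_neg_add_log hs]; exact eulerProduct_exp_ne_zero hs _)
  rw [mul_exp_neg_add_log hs] at h2
  have h3 : Real.exp (-(u + Real.log s)) = (s * Real.exp u)⁻¹ := by
    rw [Real.exp_neg, exp_add_log hs]
  rw [quasiperiodicPart, quasiperiodicPart, h2, h3, exp_add_log hs, h1]
  have hp := Real.exp_pos u
  have hs0 : 0 < s := by linarith
  field_simp
  ring

theorem hasDerivAt_quasiperiodicPart (hs : 1 < s) (u : ℝ) :
    HasDerivAt (quasiperiodicPart s) (periodicPart s u) u := by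
  have hp := Real.exp_pos u
  have h1 : HasDerivAt (fun u => mulLogDeriv s (Real.exp u)) _ u :=
    (hasDerivAt_mulLogDeriv hs (eulerProduct_exp_ne_zero hs u)).comp u (Real.hasDerivAt_exp u)
  have h2 : HasDerivAt (fun u => mulLogDeriv s (Real.exp (-u))) _ u :=
    (hasDerivAt_mulLogDeriv hs (eulerProduct_exp_ne_zero hs (-u))).comp
      (h := fun u => Real.exp (-u)) u (hasDerivAt_neg u).exp
  have h3 := ((Real.hasDerivAt_exp u).const_add 1).inv (by positivity)
  have h4 := (h1.sub h2).sub h3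
  refine (h4.congr_deriv ?_).congr_of_eventuallyEq (.of_forall fun v => ?_)
  · rw [periodicPart]
    ring
  · simp [quasiperiodicPart]

theorem continuous_periodicPart (hs : 1 < s) : Continuous (periodicPart s) := by
  have h1 : Continuous fun u => derivMulLogDeriv s (Real.exp u) :=
    continuous_iff_continuousAt.2 fun u =>
      (analyticAt_derivMulLogDeriv hs (eulerProduct_exp_ne_zero hs u)).continuousAt.comp
        Real.continuous_exp.continuousAt
  have h2 : Continuous fun u => derivMulLogDeriv s (Real.exp (-u)) := h1.comp continuous_neg
  unfold periodicPart
  refine ((Real.continuous_exp.mul h1).add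
    ((Real.continuous_exp.comp continuous_neg).mul h2)).add ?_
  exact Real.continuous_exp.div (by fun_prop) fun u => by positivity

/-- The function `z (z F'(z) / F(z))'` has an analytic continuation to the disc of radius `s`. -/
theorem exists_analytic_extension (hs : 1 < s) : ∃ h : ℂ → ℂ,
    (∀ z, ‖z‖ < s → AnalyticAt ℂ h z) ∧
    ∀ x : ℝ, |x| < s → h x = (x * derivMulLogDeriv s x : ℝ) := by
  have hF := differentiable_complexEulerProduct hs
  let M : ℂ → ℂ := fun z => z * (deriv (complexEulerProduct s) z / complexEulerProduct s z)
  have hM : ∀ z, ‖z‖ < s → AnalyticAt ℂ M z := fun z hz =>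
    analyticAt_id.mul ((hF.analyticAt z).deriv.div (hF.analyticAt z)
      (complexEulerProduct_ne_zero hs hz))
  have hMr : ∀ x : ℝ, M x = (mulLogDeriv s x : ℝ) := fun x => by
    have := deriv_ofReal_eq (hF x) (analyticAt_eulerProduct hs x).differentiableAt
      (.of_forall fun y => complexEulerProduct_ofReal hs y)
    simp [M, this, complexEulerProduct_ofReal hs, mulLogDeriv, eulerLogDeriv]
  refine ⟨fun z => z * deriv M z, fun z hz => analyticAt_id.mul (hM z hz).deriv, fun x hx => ?_⟩
  have := deriv_ofReal_eq (hM x (by simpa using hx)).differentiableAt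
    (analyticAt_mulLogDeriv hs (eulerProduct_ne_zero_of_abs_lt hs hx)).differentiableAt
    (.of_forall hMr)
  simp [this, derivMulLogDeriv]

open Filter Topology in
/-- The periodic part is not constant: in terms of `z = e^w`, its analytic continuation has a pole
at `z = -1`. -/
theorem periodicPart_not_const (hs : 1 < s) (K : ℝ) : ¬ ∀ u, periodicPart s u = K := by
  intro hK
  obtain ⟨h, han, hre⟩ := exists_analytic_extension hs
  -- Clearing the denominator makes the identity analytic on a whole vertical strip.
  let Φ : ℂ → ℂ := fun w =>
    (1 + Complex.exp w) ^ 2 * (K - h (Complex.exp w) - h (Complex.exp (-w))) - Complex.exp w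
  let U : Set ℂ := Complex.reCLM ⁻¹' Set.Ioo (-Real.log s) (Real.log s)
  have hlog : 0 < Real.log s := Real.log_pos hs
  have hU : IsPreconnected U :=
    ((convex_Ioo _ _).linear_preimage Complex.reCLM.toLinearMap).isPreconnected
  have hnorm : ∀ w ∈ U, ‖Complex.exp w‖ < s := fun w hw => by
    rw [Complex.norm_exp, ← Real.lt_log_iff_exp_lt (by linarith)]
    exact hw.2
  have hneg : ∀ w ∈ U, -w ∈ U := fun w hw => by
    have h1 := hw.1
    have h2 := hw.2
    simp only [Complex.reCLM_apply] at h1 h2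
    constructor <;> simp <;> linarith
  have hΦ : AnalyticOnNhd ℂ Φ U := fun w hw => by
    have h1 : AnalyticAt ℂ (fun w => h (Complex.exp w)) w := (han _ (hnorm w hw)).comp (by fun_prop)
    have h2 : AnalyticAt ℂ (fun w => h (Complex.exp (-w))) w :=
      (han _ (hnorm _ (hneg w hw))).comp (f := fun w => Complex.exp (-w)) (by fun_prop)
    exact (((analyticAt_const.add analyticAt_cexp).pow 2).mul
      ((analyticAt_const.sub h1).sub h2)).sub analyticAt_cexp
  have h0 : (0 : ℂ) ∈ U := by simp [U, hlog]
  have hreal : ∀ u : ℝ, u ∈ Set.Ioo (-Real.log s) (Real.log s) → Φ u = 0 := fun u hu => by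
    have e1 : |Real.exp u| < s := by
      rw [abs_of_pos (Real.exp_pos u), ← Real.lt_log_iff_exp_lt (by linarith)]
      exact hu.2
    have e2 : |Real.exp (-u)| < s := by
      rw [abs_of_pos (Real.exp_pos _), ← Real.lt_log_iff_exp_lt (by linarith)]
      linarith [hu.1]
    have e3 := hK u
    rw [periodicPart] at e3
    simp only [Φ, ← Complex.ofReal_neg, ← Complex.ofReal_exp, hre _ e1, hre _ e2]
    norm_cast
    rw [← e3]
    have := Real.exp_pos u
    field_simp
    ring
  have hfreq : ∃ᶠ w in 𝓝[≠] (0 : ℂ), Φ w = 0 := by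
    have ht : Tendsto (fun u : ℝ => (u : ℂ)) (𝓝[≠] 0) (𝓝[≠] 0) := by
      refine tendsto_nhdsWithin_iff.2 ⟨?_, ?_⟩
      · exact (Complex.continuous_ofReal.tendsto' 0 0 rfl).mono_left nhdsWithin_le_nhds
      · filter_upwards [self_mem_nhdsWithin] with u hu
        simpa using hu
    refine ht.frequently (Eventually.frequently ?_)
    filter_upwards [mem_nhdsWithin_of_mem_nhds (Ioo_mem_nhds (neg_lt_zero.2 hlog) hlog)] with u hu
    exact hreal u hu
  have hz := hΦ.eqOn_zero_of_preconnected_of_frequently_eq_zero hU h0 hfreq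
    (show (Real.pi * Complex.I : ℂ) ∈ U by simp [U, hlog])
  simp [Φ, Complex.exp_pi_mul_I] at hz

/-- The periods of a nonconstant continuous periodic function are the multiples of one of them. -/
theorem exists_periods_eq {τ : ℝ → ℝ} (hτ : Continuous τ) {a : ℝ} (ha : 0 < a)
    (hper : ∀ u, τ (u + a) = τ u) (hconst : ¬ ∀ u, τ u = τ 0) :
    ∃ m : ℕ, m ≠ 0 ∧ ∀ v, (∀ u, τ (u + v) = τ u) ↔ ∃ k : ℤ, v = k * (a / m) := by
  let G : AddSubgroup ℝ :=
    { carrier := {v | ∀ u, τ (u + v) = τ u}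
      zero_mem' := by simp
      add_mem' := fun {v w} hv hw u => by rw [← add_assoc, hw, hv]
      neg_mem' := fun {v} hv u => by simpa using (hv (u + -v)).symm }
  have hclosed : IsClosed (G : Set ℝ) := by
    have : (G : Set ℝ) = ⋂ u, {v | τ (u + v) = τ u} := by
      ext v
      simp [G]
    rw [this]
    exact isClosed_iInter fun u => isClosed_eq (by fun_prop) (by fun_prop)
  rcases G.dense_or_cyclic with hd | ⟨g, hg⟩
  · refine absurd (fun u => ?_) hconst
    have hu : u ∈ (G : Set ℝ) := by
      rw [← hclosed.closure_eq, hd.closure_eq]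
      trivial
    simpa using hu 0
  · have hmem : ∀ v, (∀ u, τ (u + v) = τ u) ↔ ∃ k : ℤ, v = k * g := fun v => by
      have : (∀ u, τ (u + v) = τ u) ↔ v ∈ G := Iff.rfl
      rw [this, hg, AddSubgroup.mem_closure_singleton]
      simp [eq_comm]
    obtain ⟨k, hk⟩ := (hmem a).1 hper
    have hk0 : k ≠ 0 := by
      rintro rfl
      simp at hk
      linarith
    refine ⟨k.natAbs, by simpa using hk0, fun v => (hmem v).trans ?_⟩
    have hkR : (k : ℝ) ≠ 0 := by exact_mod_cast hk0
    have hg' : g = a / k := by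
      rw [hk]
      field_simp
    rcases Int.natAbs_eq k with h | h
    · have : ((k.natAbs : ℕ) : ℝ) = k := by
        conv_rhs => rw [h]
        simp
      rw [this, hg']
    · have : ((k.natAbs : ℕ) : ℝ) = -k := by
        conv_rhs => rw [h]
        simp
      rw [this, hg']
      constructor
      · rintro ⟨l, rfl⟩
        exact ⟨-l, by push_cast; rw [div_neg]; ring⟩
      · rintro ⟨l, rfl⟩
        exact ⟨-l, by push_cast; rw [div_neg]; ring⟩

end

/-! ### Limits at infinity, and the first two definability results -/

section

open Filter Topology

theorem add_int_mul_of_quasiperiodic {θ : ℝ → ℝ} {a δ : ℝ} (h : ∀ u, θ (u + a) = θ u + δ) (k : ℤ)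
    (u : ℝ) : θ (u + k * a) = θ u + k * δ := by
  induction k using Int.induction_on with
  | zero => simp
  | succ n ih =>
    rw [show u + ((n : ℤ) + 1 : ℤ) * a = u + (n : ℤ) * a + a by push_cast; ring, h, ih]
    push_cast
    ring
  | pred n ih =>
    have := h (u + (-(n : ℤ) - 1 : ℤ) * a)
    rw [show u + (-(n : ℤ) - 1 : ℤ) * a + a = u + (-(n : ℤ) : ℤ) * a by push_cast; ring, ih] at this
    push_cast at *
    linarith

/-- If `h(e^u)` is asymptotic to a function `θ` that is periodic up to an additive constant, then
`h(xy) - h(x)` converges for `x → ∞` if and only if translation by `log y` changes `θ` by a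
constant: along the sequences `x = e^{u + na}` the difference tends to `θ(u + log y) - θ(u)`. -/
theorem tendsto_mul_sub_iff {h θ : ℝ → ℝ} {a δ : ℝ} (ha : 0 < a)
    (hθ : ∀ u, θ (u + a) = θ u + δ)
    (has : Tendsto (fun u => h (Real.exp u) - θ u) atTop (𝓝 0)) {y : ℝ} (hy : 0 < y) (d : ℝ) :
    Tendsto (fun x => h (x * y) - h x) atTop (𝓝 d) ↔ ∀ u, θ (u + Real.log y) = θ u + d := by
  have has' : Tendsto (fun u => h (Real.exp u * y) - θ (u + Real.log y)) atTop (𝓝 0) := by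
    refine (has.comp (tendsto_atTop_add_const_right _ (Real.log y) tendsto_id)).congr fun u => ?_
    simp [Real.exp_add, Real.exp_log hy]
  constructor
  · intro H u
    have hk : Tendsto (fun n : ℕ => u + ((n : ℤ) : ℝ) * a) atTop atTop := by
      refine tendsto_atTop_add_const_left _ _ ?_
      simpa using tendsto_natCast_atTop_atTop.atTop_mul_const ha
    have h1 := (H.comp (Real.tendsto_exp_atTop.comp hk)).sub
      ((has'.comp hk).sub (has.comp hk))
    have h2 : Tendsto (fun _ : ℕ => θ (u + Real.log y) - θ u) atTop (𝓝 d) := by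
      refine (by simpa using h1 : Tendsto _ atTop (𝓝 d)).congr fun n => ?_
      have e1 := add_int_mul_of_quasiperiodic hθ n u
      have e2 := add_int_mul_of_quasiperiodic hθ n (u + Real.log y)
      rw [show u + Real.log y + ((n : ℤ) : ℝ) * a = u + ((n : ℤ) : ℝ) * a + Real.log y by ring]
        at e2
      simp only [Function.comp_apply, Int.cast_natCast] at *
      rw [e1, e2]
      ring
    linarith [tendsto_nhds_unique h2 tendsto_const_nhds]
  · intro H
    have h1 : Tendsto (fun u => h (Real.exp u * y) - h (Real.exp u)) atTop (𝓝 d) := by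
      have := (has'.sub has).add_const d
      refine (by simpa using this : Tendsto _ atTop (𝓝 d)).congr fun u => ?_
      rw [H u]
      ring
    refine (h1.comp Real.tendsto_log_atTop).congr' ?_
    filter_upwards [eventually_gt_atTop 0] with x hx
    simp [Real.exp_log hx]

variable {s : ℝ}

theorem tendsto_comp_exp_neg {g : ℝ → ℝ} (hg : ContinuousAt g 0) :
    Tendsto (fun u => g (Real.exp (-u))) atTop (𝓝 (g 0)) :=
  hg.tendsto.comp (Real.tendsto_exp_atBot.comp tendsto_neg_atTop_atBot)

theorem tendsto_mulLogDeriv_sub_quasiperiodicPart (hs : 1 < s) :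
    Tendsto (fun u => mulLogDeriv s (Real.exp u) - quasiperiodicPart s u) atTop (𝓝 0) := by
  have h0 : eulerProduct s 0 ≠ 0 := eulerProduct_ne_zero_of_neg_one_lt hs (by norm_num)
  have h := tendsto_comp_exp_neg (g := fun x => mulLogDeriv s x + x / (1 + x))
    ((analyticAt_mulLogDeriv hs h0).continuousAt.add
      (continuousAt_id.div (by fun_prop) (by norm_num)))
  simp only [mulLogDeriv, zero_mul, zero_div, add_zero] at h
  refine h.congr fun u => ?_
  rw [quasiperiodicPart, Real.exp_neg, mulLogDeriv, mulLogDeriv]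
  have := Real.exp_pos u
  field_simp
  ring

theorem tendsto_mul_derivMulLogDeriv_sub_periodicPart (hs : 1 < s) :
    Tendsto (fun u => Real.exp u * derivMulLogDeriv s (Real.exp u) - periodicPart s u)
      atTop (𝓝 0) := by
  have h0 : eulerProduct s 0 ≠ 0 := eulerProduct_ne_zero_of_neg_one_lt hs (by norm_num)
  have h := tendsto_comp_exp_neg (g := fun x => -(x * derivMulLogDeriv s x + x / (1 + x) ^ 2))
    (((continuousAt_id.mul (analyticAt_derivMulLogDeriv hs h0).continuousAt).add
      (continuousAt_id.div (by fun_prop) (by norm_num))).neg)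
  simp only [zero_mul, zero_div, add_zero, neg_zero] at h
  refine h.congr fun u => ?_
  rw [periodicPart, Real.exp_neg]
  have := Real.exp_pos u
  field_simp
  ring

theorem exists_periods_periodicPart (hs : 1 < s) : ∃ m : ℕ, m ≠ 0 ∧ ∀ v,
    (∀ u, periodicPart s (u + v) = periodicPart s u) ↔ ∃ k : ℤ, v = k * (Real.log s / m) :=
  exists_periods_eq (continuous_periodicPart hs) (Real.log_pos hs) (periodicPart_add_log hs)
    (periodicPart_not_const hs _)

theorem exists_quasiperiodicPart_add_iff (hs : 1 < s) (v : ℝ) :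
    (∃ d, ∀ u, quasiperiodicPart s (u + v) = quasiperiodicPart s u + d) ↔
      ∀ u, periodicPart s (u + v) = periodicPart s u := by
  have hd : ∀ u, HasDerivAt (fun u => quasiperiodicPart s (u + v)) (periodicPart s (u + v)) u :=
    fun u => (hasDerivAt_quasiperiodicPart hs (u + v)).comp_add_const u v
  constructor
  · rintro ⟨d, h⟩ u
    refine (hd u).unique ?_
    rw [funext h]
    exact (hasDerivAt_quasiperiodicPart hs u).add_const d
  · intro h
    have h1 : ∀ u, HasDerivAt (fun u => quasiperiodicPart s (u + v) - quasiperiodicPart s u) 0 u :=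
      fun u => ((hd u).fun_sub (hasDerivAt_quasiperiodicPart hs u)).congr_deriv (by simp [h u])
    refine ⟨quasiperiodicPart s (0 + v) - quasiperiodicPart s 0, fun u => ?_⟩
    have := is_const_of_deriv_eq_zero (fun u => (h1 u).differentiableAt) (fun u => (h1 u).deriv) u 0
    linarith

theorem mem_rayOffPoles_of_lt (hs : 1 < s) {c x : ℝ} (hx : max c 0 < x) : x ∈ rayOffPoles s c :=
  ⟨(le_max_left _ _).trans_lt hx,
    eulerProduct_ne_zero_of_neg_one_lt hs (by linarith [le_max_right c 0])⟩

variable {S : Set RealSet}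

/-- The relation `lim_{x → ∞} (xy f(xy) - x f(x)) = d` between `y > 0` and `d` is definable from
the restriction of `f` to any set that contains a ray. -/
theorem Defines.tendsto_mul_sub {f : ℝ → ℝ} {D : Set ℝ} (hf : Defines S (restrictedGraph f D))
    {b : ℝ} (hD : ∀ x, b < x → x ∈ D) :
    Defines S ⟨2, {w | 0 < w 0 ∧
      Tendsto (fun x => x * w 0 * f (x * w 0) - x * f x) atTop (𝓝 (w 1))}⟩ := by
  have key : DefRel S fun w : Fin 2 → ℝ => 0 < w 0 ∧ ∀ ε, 0 < ε → ∃ X, ∀ x, X < x → ∀ p, ∀ q,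
      (x ∈ D ∧ p = f x) → (x * w 0 ∈ D ∧ q = f (x * w 0)) → |x * w 0 * q - x * p - w 1| < ε := by
    refine .and (.lt (.const 0) (.var _)) (.all (.imp (.lt (.const 0) (.var _)) (.ex (.all
      (.imp (.lt (.var _) (.var _)) (.all (.all (.imp (hf.mem_graph (.var _) (.var _)) (.imp
        (hf.mem_graph (.mul (.var _) (.var _)) (.var _)) (.abs_lt (.sub (.sub (.mul (.mul (.var _)
          (.var _)) (.var _)) (.mul (.var _) (.var _))) (.var _)) (.var _)))))))))))
  refine key.congr fun w => and_congr_right fun hw => ?_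
  rw [Metric.tendsto_nhds]
  refine forall₂_congr fun ε hε => ?_
  simp only [Real.dist_eq]
  constructor
  · intro h
    obtain ⟨X, hX⟩ := eventually_atTop.1 h
    refine ⟨X, fun x hx p q hp hq => ?_⟩
    rw [hp.2, hq.2]
    exact hX x hx.le
  · rintro ⟨X, hX⟩
    filter_upwards [eventually_gt_atTop X, eventually_gt_atTop b,
      eventually_gt_atTop (b / w 0)] with x h1 h2 h3
    exact hX x h1 _ _ ⟨hD x h2, rfl⟩ ⟨hD _ ((div_lt_iff₀ hw).1 h3), rfl⟩

theorem Defines.integerPowers_of_derivMulLogDerivGraph (hs : 1 < s) {c : ℝ}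
    (h : Defines S (derivMulLogDerivGraph s c)) : Defines S (integerPowers s) := by
  obtain ⟨m, hm, hper⟩ := exists_periods_periodicPart hs
  have h1 := Defines.tendsto_mul_sub (f := derivMulLogDeriv s) (D := rayOffPoles s c) h
    fun x hx => mem_rayOffPoles_of_lt hs hx
  have h2 : DefRel S fun w : Fin 1 → ℝ => ∃ y, ![y, 0] ∈ {w : Fin 2 → ℝ | 0 < w 0 ∧
      Tendsto (fun x => x * w 0 * derivMulLogDeriv s (x * w 0) - x * derivMulLogDeriv s x)
        atTop (𝓝 (w 1))} ∧ w 0 = y ^ m := by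
    refine .ex (.and (h1.subst fun i => ?_) (.eq (.var _) (.pow (.var _) m)))
    fin_cases i
    exacts [.var _, .const 0]
  refine h2.congr fun w => ?_
  have h3 : ∀ y : ℝ, 0 < y → (Tendsto (fun x => x * y * derivMulLogDeriv s (x * y) -
      x * derivMulLogDeriv s x) atTop (𝓝 0) ↔ ∃ k : ℤ, Real.log y = k * (Real.log s / m)) :=
    fun y hy => by
      rw [← hper]
      simpa using tendsto_mul_sub_iff (h := fun x => x * derivMulLogDeriv s x) (δ := 0)
        (Real.log_pos hs) (by simpa using periodicPart_add_log hs)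
        (tendsto_mul_derivMulLogDeriv_sub_periodicPart hs) hy 0
  have hmR : (m : ℝ) ≠ 0 := by exact_mod_cast hm
  have hs0 : 0 < s := by linarith
  simp only [Set.mem_ofPred_eq, Matrix.cons_val_zero, Matrix.cons_val_one]
  constructor
  · rintro ⟨k, hk⟩
    refine ⟨Real.exp (k * (Real.log s / m)), ⟨Real.exp_pos _, ?_⟩, ?_⟩
    · exact (h3 _ (Real.exp_pos _)).2 ⟨k, Real.log_exp _⟩
    · rw [← Real.exp_nat_mul, ← hk]
      rw [show (m : ℝ) * (k * (Real.log s / m)) = Real.log s * k by field_simp,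
        ← Real.rpow_def_of_pos hs0, Real.rpow_intCast]
  · rintro ⟨y, ⟨hy, ht⟩, hw⟩
    obtain ⟨k, hk⟩ := (h3 y hy).1 ht
    refine ⟨k, ?_⟩
    rw [hw, ← Real.exp_log hy, hk, ← Real.exp_nat_mul,
      show (m : ℝ) * (k * (Real.log s / m)) = Real.log s * k by field_simp,
        ← Real.rpow_def_of_pos hs0, Real.rpow_intCast]

theorem Defines.integers_of_logDerivGraph (hs : 1 < s) {c : ℝ}
    (h : Defines S (logDerivGraph s c)) : Defines S integers := by
  obtain ⟨m, hm, hper⟩ := exists_periods_periodicPart hs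
  have h1 := Defines.tendsto_mul_sub (f := eulerLogDeriv s) (D := rayOffPoles s c) h
    fun x hx => mem_rayOffPoles_of_lt hs hx
  have h2 : DefRel S fun w : Fin 1 → ℝ => ∃ y d, ![y, d] ∈ {w : Fin 2 → ℝ | 0 < w 0 ∧
      Tendsto (fun x => x * w 0 * eulerLogDeriv s (x * w 0) - x * eulerLogDeriv s x)
        atTop (𝓝 (w 1))} ∧ w 0 = m * d := by
    refine .ex (.ex (.and (h1.subst fun i => ?_) (.eq (.var _) (.mul (.const m) (.var _)))))
    fin_cases i
    exacts [.var _, .var _]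
  refine h2.congr fun w => ?_
  have h3 : ∀ y d : ℝ, 0 < y → (Tendsto (fun x => x * y * eulerLogDeriv s (x * y) -
      x * eulerLogDeriv s x) atTop (𝓝 d) ↔
      ∀ u, quasiperiodicPart s (u + Real.log y) = quasiperiodicPart s u + d) :=
    fun y d hy => tendsto_mul_sub_iff (h := mulLogDeriv s)
        (Real.log_pos hs) (quasiperiodicPart_add_log hs)
        (tendsto_mulLogDeriv_sub_quasiperiodicPart hs) hy d
  have hmR : (m : ℝ) ≠ 0 := by exact_mod_cast hm
  -- A translation by `k (log s) / m`, repeated `m` times, is `k` times the one by `log s`.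
  have h4 : ∀ (k : ℤ) (v d : ℝ), v = k * (Real.log s / m) →
      (∀ u, quasiperiodicPart s (u + v) = quasiperiodicPart s u + d) → (m : ℝ) * d = k := by
    intro k v d hv hd
    have e1 := add_int_mul_of_quasiperiodic hd m 0
    have e2 := add_int_mul_of_quasiperiodic (quasiperiodicPart_add_log hs) k 0
    rw [show (0 : ℝ) + (m : ℤ) * v = 0 + k * Real.log s by rw [hv]; push_cast; field_simp] at e1
    push_cast at *
    linarith
  simp only [Set.mem_ofPred_eq, Matrix.cons_val_zero, Matrix.cons_val_one]
  constructor
  · rintro ⟨k, hk⟩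
    obtain ⟨d, hd⟩ := (exists_quasiperiodicPart_add_iff hs (k * (Real.log s / m))).2
      ((hper _).2 ⟨k, rfl⟩)
    refine ⟨Real.exp (k * (Real.log s / m)), d, ⟨Real.exp_pos _, ?_⟩, ?_⟩
    · rw [h3 _ _ (Real.exp_pos _), Real.log_exp]
      exact hd
    · rw [h4 k _ d rfl hd]
      exact hk.symm
  · rintro ⟨y, d, ⟨hy, ht⟩, hw⟩
    have hd := (h3 y d hy).1 ht
    obtain ⟨k, hk⟩ := (hper _).1 ((exists_quasiperiodicPart_add_iff hs _).1 ⟨d, hd⟩)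
    exact ⟨k, by rw [hw, h4 k _ d hk hd]⟩

end

/-! ### Coding a sequence by one real number -/

section

open Filter Topology MeasureTheory

/-- An uncountable set of real numbers has distinct points as close as desired. -/
theorem exists_close_pair_of_not_countable {T : Set ℝ} (hT : ¬ T.Countable) {δ : ℝ} (hδ : 0 < δ) :
    ∃ p ∈ T, ∃ q ∈ T, p < q ∧ q < p + δ := by
  by_contra! H
  refine hT ((Set.mapsTo_univ (fun x => ⌊x / δ⌋) T).countable_of_injOn (fun p hp q hq hpq => ?_)
    (Set.countable_univ))
  have hlt := Int.abs_sub_lt_one_of_floor_eq_floor hpq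
  rw [← sub_div, abs_div, abs_of_pos hδ, div_lt_one hδ, abs_lt] at hlt
  rcases lt_trichotomy p q with h | h | h
  · linarith [H p hp q hq h]
  · exact h
  · linarith [H q hq p hp h]

variable {x : ℕ → ℝ} {t : ℝ}

/-- A short interval to the right of `x n` has points that lie in none of the later intervals
`[x l, x l + t⁻ˡ]`, and any two of them can be chosen as close as needed: the next intervals are
far from `x n`, and the remaining ones have too small a total length. -/
theorem eventually_exists_close_pair_avoiding (ht : 1 < t)
    (hsep : ∀ i, 1 ≤ i → ∃ ε > 0, ∀ n, ε ≤ |x (n + i) - x n|) {lo hi : ℝ} (hlo : 0 ≤ lo)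
    (hlohi : lo < hi) (hhi : hi ≤ 1) :
    ∀ᶠ n in atTop, ∀ δ > 0, ∃ p q, p < q ∧ q < p + δ ∧ x n + lo * (t ^ n)⁻¹ < p ∧
      q < x n + hi * (t ^ n)⁻¹ ∧ ∀ l, n < l →
        p ∉ Set.Icc (x l) (x l + (t ^ l)⁻¹) ∧ q ∉ Set.Icc (x l) (x l + (t ^ l)⁻¹) := by
  have ht0 : 0 < t := by linarith
  have ht1 : t⁻¹ < 1 := inv_lt_one_of_one_lt₀ ht
  have hpow : Tendsto (fun n : ℕ => (t ^ n)⁻¹) atTop (𝓝 0) := by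
    simpa using tendsto_pow_atTop_nhds_zero_of_lt_one (by positivity) ht1
  have hgeo : ∀ m : ℕ, HasSum (fun k : ℕ => (t ^ (m + k))⁻¹) ((t ^ m)⁻¹ * (1 - t⁻¹)⁻¹) := by
    intro m
    refine ((hasSum_geometric_of_lt_one (by positivity) ht1).mul_left ((t ^ m)⁻¹)).congr_fun ?_
    intro k
    rw [pow_add, mul_inv, inv_pow]
  obtain ⟨N, hN⟩ : ∃ N : ℕ, (t ^ (N + 1))⁻¹ * (1 - t⁻¹)⁻¹ < hi - lo := by
    have h1 : Tendsto (fun N : ℕ => (t ^ (N + 1))⁻¹ * (1 - t⁻¹)⁻¹) atTop (𝓝 0) := by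
      simpa using (hpow.comp (tendsto_add_atTop_nat 1)).mul_const ((1 - t⁻¹)⁻¹)
    exact (h1.eventually_lt_const (by linarith)).exists
  have hnear : ∀ᶠ n in atTop, ∀ i ∈ Finset.Icc 1 N, 2 * (t ^ n)⁻¹ < |x (n + i) - x n| := by
    rw [eventually_all_finset]
    intro i hi
    obtain ⟨ε, hε, h⟩ := hsep i (Finset.mem_Icc.1 hi).1
    have h1 : Tendsto (fun n : ℕ => 2 * (t ^ n)⁻¹) atTop (𝓝 0) := by simpa using hpow.const_mul 2
    filter_upwards [h1.eventually_lt_const hε] with n hn using hn.trans_le (h n)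
  filter_upwards [hnear] with n hn δ hδ
  have htn : 0 < (t ^ n)⁻¹ := by positivity
  let J := Set.Ioo (x n + lo * (t ^ n)⁻¹) (x n + hi * (t ^ n)⁻¹)
  let W : Set ℝ := ⋃ k : ℕ,
    Set.Icc (x (n + N + 1 + k)) (x (n + N + 1 + k) + (t ^ (n + N + 1 + k))⁻¹)
  have hW : volume W ≤ ENNReal.ofReal ((t ^ (n + N + 1))⁻¹ * (1 - t⁻¹)⁻¹) := by
    refine (measure_iUnion_le _).trans ?_
    simp only [Real.volume_Icc, add_sub_cancel_left]
    rw [← ENNReal.ofReal_tsum_of_nonneg (fun k => by positivity) (hgeo _).summable,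
      (hgeo _).tsum_eq]
  have hJ : volume J = ENNReal.ofReal ((hi - lo) * (t ^ n)⁻¹) := by
    rw [Real.volume_Ioo]
    congr 1
    ring
  have hlt : volume W < volume J := by
    refine hW.trans_lt ?_
    rw [hJ, ENNReal.ofReal_lt_ofReal_iff (mul_pos (by linarith) htn)]
    calc (t ^ (n + N + 1))⁻¹ * (1 - t⁻¹)⁻¹ = (t ^ (N + 1))⁻¹ * (1 - t⁻¹)⁻¹ * (t ^ n)⁻¹ := by
          rw [add_assoc, pow_add, mul_inv]
          ring
      _ < _ := mul_lt_mul_of_pos_right hN htn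
  have hunc : ¬ (J \ W).Countable := fun hc => by
    refine hlt.not_ge ?_
    calc volume J ≤ volume ((J \ W) ∪ W) := measure_mono fun z hz => by
          by_cases h : z ∈ W
          exacts [Or.inr h, Or.inl ⟨hz, h⟩]
      _ ≤ volume (J \ W) + volume W := measure_union_le _ _
      _ = volume W := by rw [hc.measure_zero, zero_add]
  have havoid : ∀ z ∈ J \ W, ∀ l, n < l → z ∉ Set.Icc (x l) (x l + (t ^ l)⁻¹) := by
    rintro z ⟨hzJ, hzW⟩ l hl hzl
    rcases le_or_gt l (n + N) with h | h
    · have h1 := hn (l - n) (Finset.mem_Icc.2 (by omega))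
      rw [show n + (l - n) = l by omega] at h1
      have h2 : (t ^ l)⁻¹ ≤ (t ^ n)⁻¹ := by
        gcongr
        exact ht.le
      have h3 : lo * (t ^ n)⁻¹ ≥ 0 := by positivity
      have h4 : hi * (t ^ n)⁻¹ ≤ (t ^ n)⁻¹ := mul_le_of_le_one_left htn.le hhi
      have h5 := hzJ.1
      have h6 := hzJ.2
      have h7 := hzl.1
      have h8 := hzl.2
      rcases lt_abs.1 h1 with h9 | h9 <;> linarith
    · refine hzW (Set.mem_iUnion.2 ⟨l - (n + N + 1), ?_⟩)
      rw [show n + N + 1 + (l - (n + N + 1)) = l by omega]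
      exact hzl
  obtain ⟨p, hp, q, hq, hpq, hqδ⟩ := exists_close_pair_of_not_countable hunc hδ
  exact ⟨p, q, hpq, hqδ, hp.1.1, hq.1.2, fun l hl => ⟨havoid p hp l hl, havoid q hq l hl⟩⟩

/-- From an index `n`, one reaches a later index `m` whose interval `[x m, x m + t⁻ᵐ]` lies at a
prescribed place to the right of `x n` and meets none of the intervals in between. -/
theorem eventually_exists_next (ht : 1 < t)
    (hsep : ∀ i, 1 ≤ i → ∃ ε > 0, ∀ n, ε ≤ |x (n + i) - x n|) {α β : ℝ}
    (hdense : ∀ p q, α ≤ p → p < q → q ≤ β → ∃ᶠ n in atTop, x n ∈ Set.Ioo p q)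
    {lo hi : ℝ} (hlo : 0 ≤ lo) (hlohi : lo < hi) (hhi : hi ≤ 1) :
    ∀ᶠ n in atTop, Set.Icc (x n) (x n + (t ^ n)⁻¹) ⊆ Set.Icc α β → ∀ Y, ∃ m, Y ≤ m ∧ n < m ∧
      Set.Icc (x m) (x m + (t ^ m)⁻¹) ⊆
        Set.Ioo (x n + lo * (t ^ n)⁻¹) (x n + hi * (t ^ n)⁻¹) ∧
      ∀ l, n < l → l < m →
        Disjoint (Set.Icc (x l) (x l + (t ^ l)⁻¹)) (Set.Icc (x m) (x m + (t ^ m)⁻¹)) := by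
  have ht0 : 0 < t := by linarith
  filter_upwards [eventually_exists_close_pair_avoiding ht hsep hlo hlohi hhi] with n hn hsub Y
  have htn : 0 < (t ^ n)⁻¹ := by positivity
  obtain ⟨p, q, hpq, hqY, hp, hq, hav⟩ := hn (t ^ Y)⁻¹ (by positivity)
  have h3 : 0 ≤ lo * (t ^ n)⁻¹ := by positivity
  have h4 : hi * (t ^ n)⁻¹ ≤ (t ^ n)⁻¹ := mul_le_of_le_one_left htn.le hhi
  have hαx : α ≤ x n := (hsub ⟨le_rfl, by linarith⟩).1
  have hxβ : x n + (t ^ n)⁻¹ ≤ β := (hsub ⟨by linarith, le_rfl⟩).2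
  have hex : ∃ m, n < m ∧ p < x m ∧ x m + (t ^ m)⁻¹ < q := by
    have hpow : Tendsto (fun n : ℕ => (t ^ n)⁻¹) atTop (𝓝 0) := by
      simpa using tendsto_pow_atTop_nhds_zero_of_lt_one (by positivity) (inv_lt_one_of_one_lt₀ ht)
    obtain ⟨m, hm, hm1, hm2⟩ := ((hdense p ((p + q) / 2) (by linarith) (by linarith)
      (by linarith)).and_eventually ((eventually_gt_atTop n).and
        (hpow.eventually_lt_const (show 0 < (q - p) / 2 by linarith)))).exists
    exact ⟨m, hm1, hm.1, by linarith [hm.2]⟩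
  classical
  -- The intervals of indices before the least such `m` contain neither `p` nor `q`, and none of
  -- them lies between `p` and `q`.
  obtain ⟨hm1, hm2, hm3⟩ := Nat.find_spec hex
  have hmin := fun l => Nat.find_min hex (m := l)
  generalize Nat.find hex = m at *
  refine ⟨m, ?_, hm1, fun z hz => ⟨by linarith [hz.1], by linarith [hz.2]⟩, fun l hl hlm => ?_⟩
  · by_contra! hmY
    have : (t ^ Y)⁻¹ ≤ (t ^ m)⁻¹ := by
      gcongr
      exact ht.le
    linarith
  · have h5 : ¬ (p < x l ∧ x l + (t ^ l)⁻¹ < q) := fun h => hmin l hlm ⟨hl, h⟩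
    obtain ⟨h6, h7⟩ := hav l hl
    rw [Set.mem_Icc] at h6 h7
    refine Set.disjoint_left.2 fun z hz1 hz2 => ?_
    have := hz1.1
    have := hz1.2
    have := hz2.1
    have := hz2.2
    by_cases h8 : p < x l
    · exact h7 ⟨by linarith, not_lt.1 fun h => h5 ⟨h8, h⟩⟩
    · exact h6 ⟨not_lt.1 h8, by linarith⟩

/-- A real number `c` can be chosen so that `t^l (c - x l)`, at the indices `l` where it lies in the
unit interval, runs through any prescribed sequence of windows. -/
theorem exists_coding (ht : 1 < t)
    (hsep : ∀ i, 1 ≤ i → ∃ ε > 0, ∀ n, ε ≤ |x (n + i) - x n|) {α β : ℝ} (hαβ : α < β)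
    (hdense : ∀ p q, α ≤ p → p < q → q ≤ β → ∃ᶠ n in atTop, x n ∈ Set.Ioo p q)
    {lo hi : ℕ → ℝ} (hlo : ∀ j, 0 ≤ lo j) (hlohi : ∀ j, lo j < hi j) (hhi : ∀ j, hi j ≤ 1) :
    ∃ (c : ℝ) (n : ℕ → ℕ), StrictMono n ∧
      (∀ j, t ^ n j * (c - x (n j)) ∈ Set.Ioo (lo j) (hi j)) ∧
      ∀ l, n 0 ≤ l → t ^ l * (c - x l) ∈ Set.Icc 0 1 → ∃ j, l = n j := by
  have ht0 : 0 < t := by linarith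
  let I : ℕ → Set ℝ := fun l => Set.Icc (x l) (x l + (t ^ l)⁻¹)
  have hpow : Tendsto (fun n : ℕ => (t ^ n)⁻¹) atTop (𝓝 0) := by
    simpa using tendsto_pow_atTop_nhds_zero_of_lt_one (by positivity) (inv_lt_one_of_one_lt₀ ht)
  choose b hb using fun j =>
    eventually_atTop.1 (eventually_exists_next ht hsep hdense (hlo j) (hlohi j) (hhi j))
  let State : ℕ → Type := fun j => {n : ℕ // b j ≤ n ∧ I n ⊆ Set.Icc α β}
  have hJI : ∀ j n, Set.Ioo (x n + lo j * (t ^ n)⁻¹) (x n + hi j * (t ^ n)⁻¹) ⊆ I n :=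
    fun j n z hz => by
      have htn : 0 < (t ^ n)⁻¹ := by positivity
      have h3 : 0 ≤ lo j * (t ^ n)⁻¹ := mul_nonneg (hlo j) htn.le
      have h4 : hi j * (t ^ n)⁻¹ ≤ (t ^ n)⁻¹ := mul_le_of_le_one_left htn.le (hhi j)
      exact ⟨by linarith [hz.1], by linarith [hz.2]⟩
  have hstep : ∀ j (n : State j), ∃ m : State (j + 1), n.1 < m.1 ∧
      I m.1 ⊆ Set.Ioo (x n.1 + lo j * (t ^ n.1)⁻¹) (x n.1 + hi j * (t ^ n.1)⁻¹) ∧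
      ∀ l, n.1 < l → l < m.1 → Disjoint (I l) (I m.1) := fun j n => by
    obtain ⟨m, hm1, hm2, hm3, hm4⟩ := hb j n.1 n.2.1 n.2.2 (b (j + 1))
    exact ⟨⟨m, hm1, hm3.trans ((hJI j n.1).trans n.2.2)⟩, hm2, hm3, hm4⟩
  have hstart : Nonempty (State 0) := by
    obtain ⟨m, hm, hm1, hm2⟩ := ((hdense α ((α + β) / 2) le_rfl (by linarith)
      (by linarith)).and_eventually ((eventually_ge_atTop (b 0)).and
        (hpow.eventually_lt_const (show 0 < (β - α) / 2 by linarith)))).exists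
    exact ⟨m, hm1, fun z hz => ⟨by linarith [hz.1, hm.1], by linarith [hz.2, hm.2]⟩⟩
  choose next hnext using hstep
  let σ : ∀ j, State j := fun j => Nat.rec hstart.some (fun j n => next j n) j
  let n : ℕ → ℕ := fun j => (σ j).1
  have hn : ∀ j, n j < n (j + 1) ∧
      I (n (j + 1)) ⊆ Set.Ioo (x (n j) + lo j * (t ^ n j)⁻¹) (x (n j) + hi j * (t ^ n j)⁻¹) ∧
      ∀ l, n j < l → l < n (j + 1) → Disjoint (I l) (I (n (j + 1))) := fun j => hnext j (σ j)
  have hmono : StrictMono n := strictMono_nat_of_lt_succ fun j => (hn j).1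
  obtain ⟨c, hc⟩ : (⋂ j, I (n j)).Nonempty :=
    IsCompact.nonempty_iInter_of_sequence_nonempty_isCompact_isClosed _
      (fun j => (hn j).2.1.trans (hJI j _))
      (fun j => Set.nonempty_Icc.2 (by have : 0 < (t ^ n j)⁻¹ := by positivity
                                       linarith))
      isCompact_Icc fun j => isClosed_Icc
  rw [Set.mem_iInter] at hc
  refine ⟨c, n, hmono, fun j => ?_, fun l hl hcl => ?_⟩
  · obtain ⟨h1, h2⟩ := (hn j).2.1 (hc (j + 1))
    have hp : 0 < t ^ n j := by positivity
    rw [mul_comm]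
    exact ⟨(mul_inv_lt_iff₀ hp).1 (by linarith), (lt_mul_inv_iff₀ hp).1 (by linarith)⟩
  · have hcI : c ∈ I l := by
      have hp : 0 < t ^ l := by positivity
      have h1 : 0 ≤ c - x l := (mul_nonneg_iff_of_pos_left hp).1 hcl.1
      have h2 : c - x l ≤ (t ^ l)⁻¹ := by
        rw [← one_div, le_div_iff₀ hp, mul_comm]
        exact hcl.2
      exact ⟨by linarith, by linarith⟩
    obtain ⟨j, hj1, hj2⟩ : ∃ j, n j ≤ l ∧ l < n (j + 1) := by
      by_contra! H
      have hall : ∀ j, n j ≤ l := fun j => by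
        induction j with
        | zero => exact hl
        | succ j ih => exact H j ih
      have := hmono.id_le (l + 1)
      have := hall (l + 1)
      simp only [id] at *
      omega
    refine ⟨j, by_contra fun hne => ?_⟩
    exact Set.disjoint_left.1 ((hn j).2.2 l (by omega) hj2) hcI (hc (j + 1))

/-- A real number `c` can be chosen so that the limit points greater than `1` of the sequence
`1 / (t^l (c - x l))` are exactly the integers greater than `1`. -/
theorem exists_coding_integers (ht : 1 < t)
    (hsep : ∀ i, 1 ≤ i → ∃ ε > 0, ∀ n, ε ≤ |x (n + i) - x n|) {α β : ℝ} (hαβ : α < β)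
    (hdense : ∀ p q, α ≤ p → p < q → q ≤ β → ∃ᶠ n in atTop, x n ∈ Set.Ioo p q) :
    ∃ c : ℝ, ∀ y, 1 < y → ((∀ ε > 0, ∀ X, ∃ l ≥ X, |(t ^ l * (c - x l))⁻¹ - y| < ε) ↔
      ∃ k : ℕ, y = k + 2) := by
  -- The window of index `j` makes the inverse exceed an integer by less than `1 / (j + 1)`, and
  -- each integer is approached infinitely often.
  let κ : ℕ → ℝ := fun j => ((Nat.unpair j).1 : ℝ) + 2
  have hκ : ∀ j, 2 ≤ κ j := fun j => by simp [κ]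
  have hj0 : ∀ j : ℕ, (0 : ℝ) < 1 / (j + 1) := fun j => by positivity
  obtain ⟨c, n, hmono, hwin, hall⟩ := exists_coding ht hsep hαβ hdense
    (lo := fun j => (κ j + 1 / (j + 1))⁻¹) (hi := fun j => (κ j)⁻¹)
    (fun j => by have := hκ j; have := hj0 j; positivity)
    (fun j => inv_strictAnti₀ (by linarith [hκ j]) (by linarith [hj0 j]))
    (fun j => inv_le_one_of_one_le₀ (by linarith [hκ j]))
  have hval : ∀ j, |(t ^ n j * (c - x (n j)))⁻¹ - κ j| < 1 / (j + 1) := fun j => by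
    obtain ⟨h1, h2⟩ := hwin j
    have hk := hκ j
    have hj := hj0 j
    have hlo : 0 < (κ j + 1 / ((j : ℝ) + 1))⁻¹ := by positivity
    have h3 := inv_strictAnti₀ hlo h1
    have h4 := inv_strictAnti₀ (hlo.trans h1) h2
    rw [inv_inv] at h3 h4
    rw [abs_lt]
    constructor <;> linarith
  have hidx : ∀ j, j ≤ n j := hmono.id_le
  refine ⟨c, fun y hy => ⟨fun H => ?_, ?_⟩⟩
  · have hmem : y ∈ Set.range ((↑) : ℤ → ℝ) := by
      refine (Metric.mem_of_closed' Int.isClosedEmbedding_coe_real.isClosed_range).2 fun ε hε => ?_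
      obtain ⟨J, hJ⟩ := exists_nat_one_div_lt (half_pos hε)
      obtain ⟨l, hl, hly⟩ := H (min (ε / 2) (y - 1)) (lt_min (half_pos hε) (by linarith)) (n J)
      have h1 := abs_lt.1 (hly.trans_le (min_le_right _ _))
      have h2 : 1 < (t ^ l * (c - x l))⁻¹ := by linarith [h1.1]
      have h3 : 0 < t ^ l * (c - x l) := inv_pos.1 (by linarith)
      obtain ⟨j, rfl⟩ := hall l ((hmono.monotone (Nat.zero_le J)).trans hl)
        ⟨h3.le, ((one_lt_inv₀ h3).1 h2).le⟩
      have hjJ : (J : ℝ) ≤ j := by exact_mod_cast hmono.le_iff_le.1 hl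
      have h4 : 1 / ((j : ℝ) + 1) ≤ 1 / (J + 1) := by gcongr
      refine ⟨κ j, ⟨((Nat.unpair j).1 + 2 : ℕ), by simp [κ]⟩, ?_⟩
      rw [Real.dist_eq]
      have h5 := abs_lt.1 (hly.trans_le (min_le_left _ _))
      have h6 := abs_lt.1 (hval j)
      rw [abs_lt]
      constructor <;> linarith [h5.1, h5.2, h6.1, h6.2]
    obtain ⟨z, rfl⟩ := hmem
    have hz : 1 < z := by exact_mod_cast hy
    refine ⟨(z - 2).toNat, ?_⟩
    have : (((z - 2).toNat : ℤ) : ℝ) = ((z - 2 : ℤ) : ℝ) := by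
      rw [Int.toNat_of_nonneg (by omega)]
    push_cast at this
    linarith
  · rintro ⟨k, rfl⟩ ε hε X
    obtain ⟨J, hJ⟩ := exists_nat_one_div_lt hε
    let j := Nat.pair k (max J X)
    have hjle : max J X ≤ j := Nat.right_le_pair _ _
    have hjJ : (J : ℝ) ≤ j := by exact_mod_cast (le_max_left J X).trans hjle
    have h4 : 1 / ((j : ℝ) + 1) ≤ 1 / (J + 1) := by gcongr
    refine ⟨n j, ((le_max_right J X).trans hjle).trans (hidx j), ?_⟩
    have h5 := hval j
    rw [show κ j = k + 2 by simp [κ, j] ] at h5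
    linarith

end

/-! ### The integers from two groups of powers -/

section

open Filter Topology

theorem fract_mul_add_sub (r : ℝ) (n i : ℕ) : ∃ z : ℤ,
    Int.fract (r * ((n + i : ℕ) : ℝ)) - Int.fract (r * n) = r * i - z :=
  ⟨⌊r * ((n + i : ℕ) : ℝ)⌋ - ⌊r * n⌋, by rw [Int.fract, Int.fract]; push_cast; ring⟩

/-- The points `s^{rn}`, reduced modulo powers of `s`, are separated uniformly in `n` from their
`i`-th successors, because rotations are isometries. -/
theorem exists_separation_rpow_fract {s r : ℝ} (hs : 1 < s) (hr : Irrational r) {i : ℕ}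
    (hi : 1 ≤ i) :
    ∃ ε > 0, ∀ n : ℕ, ε ≤ |s ^ Int.fract (r * ((n + i : ℕ) : ℝ)) - s ^ Int.fract (r * n)| := by
  have hlog : 0 < Real.log s := Real.log_pos hs
  have hs0 : 0 < s := by linarith
  have hirr : Irrational (r * i) := hr.mul_natCast (by omega)
  have hpos : 0 < |r * i - round (r * i)| := abs_pos.2 (sub_ne_zero.2 (hirr.ne_int _))
  have hexp : ∀ p q : ℝ, 0 ≤ q → q ≤ p → Real.log s * (p - q) ≤ s ^ p - s ^ q := by
    intro p q hq hqp
    have h1 : 1 ≤ s ^ q := Real.one_le_rpow hs.le hq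
    have h2 : Real.log s * (p - q) + 1 ≤ s ^ (p - q) := by
      rw [Real.rpow_def_of_pos hs0]
      exact Real.add_one_le_exp _
    have h3 : s ^ p = s ^ q * s ^ (p - q) := by
      rw [← Real.rpow_add hs0]
      congr 1
      ring
    have h4 : 0 ≤ Real.log s * (p - q) := mul_nonneg hlog.le (by linarith)
    rw [h3]
    nlinarith
  refine ⟨Real.log s * |r * i - round (r * i)|, mul_pos hlog hpos, fun n => ?_⟩
  obtain ⟨z, hz⟩ := fract_mul_add_sub r n i
  have h1 : |r * i - round (r * i)| ≤
      |Int.fract (r * ((n + i : ℕ) : ℝ)) - Int.fract (r * n)| := by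
    rw [hz]
    exact round_le _ z
  refine (mul_le_mul_of_nonneg_left h1 hlog.le).trans ?_
  have f1 := Int.fract_nonneg (r * ((n + i : ℕ) : ℝ))
  have f2 := Int.fract_nonneg (r * n)
  generalize Int.fract (r * ((n + i : ℕ) : ℝ)) = p at *
  generalize Int.fract (r * n) = q at *
  rcases le_total q p with h | h
  · rw [abs_of_nonneg (sub_nonneg.2 h)]
    exact (hexp p q f2 h).trans (le_abs_self _)
  · rw [abs_sub_comm p q, abs_of_nonneg (sub_nonneg.2 h), abs_sub_comm]
    exact (hexp q p f1 h).trans (le_abs_self _)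

theorem frequently_fract_mul_mem_Ioo {r : ℝ} (hr : Irrational r) {p q : ℝ} (hp : 0 ≤ p)
    (hpq : p < q) (hq : q ≤ 1) : ∃ᶠ n : ℕ in atTop, Int.fract (r * n) ∈ Set.Ioo p q := by
  have hd : DenseRange (fun n : ℤ => n • (r : AddCircle (1 : ℝ))) := by
    rw [AddCircle.denseRange_zsmul_coe_iff]
    simpa using hr
  let θ : ℝ := (p + q) / 2
  have hcl : MapClusterPt (θ : AddCircle (1 : ℝ)) atTop
      (fun n : ℕ => n • (r : AddCircle (1 : ℝ))) :=
    ((mapClusterPt_atTop_nsmul_tfae _ _).out 0 3).2 (hd _)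
  have hopen : IsOpen (((↑) : ℝ → AddCircle (1 : ℝ)) '' Set.Ioo p q) :=
    QuotientAddGroup.isOpenMap_coe _ isOpen_Ioo
  have hmem : (θ : AddCircle (1 : ℝ)) ∈ ((↑) : ℝ → AddCircle (1 : ℝ)) '' Set.Ioo p q :=
    ⟨θ, ⟨by simp only [θ]; linarith, by simp only [θ]; linarith⟩, rfl⟩
  refine (hcl.frequently (hopen.mem_nhds hmem)).mono fun n hn => ?_
  obtain ⟨y, hy, hyn⟩ := hn
  rw [← AddCircle.coe_nsmul, QuotientAddGroup.eq, AddSubgroup.mem_zmultiples_iff] at hyn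
  obtain ⟨k, hk⟩ := hyn
  have h1 : r * n = y + k := by
    simp only [zsmul_eq_mul, mul_one, nsmul_eq_mul] at hk
    linarith
  rw [h1, Int.fract_add_intCast, Int.fract_eq_self.2 ⟨hp.trans hy.1.le, hy.2.trans_le hq⟩]
  exact hy

theorem frequently_rpow_fract_mem_Ioo {s r : ℝ} (hs : 1 < s) (hr : Irrational r) {p q : ℝ}
    (hp : 1 ≤ p) (hpq : p < q) (hq : q ≤ s) :
    ∃ᶠ n : ℕ in atTop, s ^ Int.fract (r * n) ∈ Set.Ioo p q := by
  refine (frequently_fract_mul_mem_Ioo hr (p := Real.logb s p) (q := Real.logb s q)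
    (Real.logb_nonneg hs hp) (Real.logb_lt_logb hs (by linarith) hpq)
    ((Real.logb_le_logb_of_le hs (by linarith) hq).trans_eq
      (Real.logb_self_eq_one hs))).mono fun n hn => ?_
  exact ⟨(Real.logb_lt_iff_lt_rpow hs (by linarith)).1 hn.1,
    (Real.lt_logb_iff_rpow_lt hs (by linarith)).1 hn.2⟩

/-- For `b = s^{rl}`, the power `a` of `s` with `a ≤ b < s a` has `b / a = s^{fract (rl)}`. -/
theorem zpow_bracket_iff {s r : ℝ} (hs : 1 < s) (l : ℕ) (k : ℤ) :
    (s ^ k ≤ (s ^ r) ^ l ∧ (s ^ r) ^ l < s * s ^ k) ↔ k = ⌊r * l⌋ := by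
  have hs0 : 0 < s := by linarith
  rw [← Real.rpow_mul_natCast hs0.le, ← zpow_one_add₀ hs0.ne', ← Real.rpow_intCast,
    ← Real.rpow_intCast, Real.rpow_le_rpow_left_iff hs, Real.rpow_lt_rpow_left_iff hs, eq_comm,
    Int.floor_eq_iff, Int.cast_add, Int.cast_one, add_comm (1 : ℝ)]

theorem rpow_pow_div_zpow_floor {s r : ℝ} (hs : 1 < s) (l : ℕ) :
    (s ^ r) ^ l / s ^ ⌊r * l⌋ = s ^ Int.fract (r * l) := by
  have hs0 : 0 < s := by linarith
  rw [← Real.rpow_mul_natCast hs0.le, ← Real.rpow_intCast, ← Real.rpow_sub hs0, Int.fract]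

variable {S : Set RealSet}

/-- The powers of `s` and of `s^r`, for irrational `r`, together define the set of integers. -/
theorem Defines.integers_of_integerPowers {s r : ℝ} (hs : 1 < s) (hr0 : 0 < r)
    (hr : Irrational r) (hA : Defines S (integerPowers s))
    (hB : Defines S (integerPowers (s ^ r))) :
    Defines S integers := by
  have hs0 : 0 < s := by linarith
  have ht : 1 < s ^ r := Real.one_lt_rpow hs hr0
  obtain ⟨c, hc⟩ := exists_coding_integers (x := fun n : ℕ => s ^ Int.fract (r * n)) ht
    (fun i hi => exists_separation_rpow_fract hs hr hi) (α := 1) (β := s) hs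
    (fun p q hp hpq hq => frequently_rpow_fract_mem_Ioo hs hr hp hpq hq)
  have h1 : DefRel S fun w : Fin 1 → ℝ => 1 < w 0 ∧ ∀ ε, 0 < ε → ∀ X, ∃ a b,
      a ∈ Set.range (fun k : ℤ => s ^ k) ∧ b ∈ Set.range (fun k : ℤ => (s ^ r) ^ k) ∧ X < b ∧
      a ≤ b ∧ b < s * a ∧ |(b * (c - b / a))⁻¹ - w 0| < ε :=
    .and (.lt (.const 1) (.var _)) (.all (.imp (.lt (.const 0) (.var _)) (.all (.ex (.ex
      (.and (hA.mem_unary (.var _)) (.and (hB.mem_unary (.var _)) (.and (.lt (.var _) (.var _))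
      (.and (.le (.var _) (.var _)) (.and (.lt (.var _) (.mul (.const s) (.var _)))
      (.abs_lt (.sub (.inv (.mul (.var _) (.sub (.const c) (.div (.var _) (.var _))))) (.var _))
        (.var _))))))))))))
  have h2 : Defines S (unarySet (Set.range fun k : ℕ => (k : ℝ) + 2)) := by
    refine h1.congr fun w => ?_
    change w 0 ∈ Set.range (fun k : ℕ => (k : ℝ) + 2) ↔ _
    generalize w 0 = y
    have key : 1 < y → ((∀ ε, 0 < ε → ∀ X, ∃ a b,
        a ∈ Set.range (fun k : ℤ => s ^ k) ∧ b ∈ Set.range (fun k : ℤ => (s ^ r) ^ k) ∧ X < b ∧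
        a ≤ b ∧ b < s * a ∧ |(b * (c - b / a))⁻¹ - y| < ε) ↔ ∃ k : ℕ, y = k + 2) := by
      intro hy
      rw [← hc y hy]
      refine forall₂_congr fun ε hε => ⟨fun H X => ?_, fun H X => ?_⟩
      · obtain ⟨_, _, ⟨k, rfl⟩, ⟨n, rfl⟩, hX, h3, h4, h5⟩ := H ((s ^ r) ^ X)
        simp only at *
        rw [← zpow_natCast, zpow_lt_zpow_iff_right₀ ht] at hX
        lift n to ℕ using by omega
        rw [zpow_natCast] at *
        rw [(zpow_bracket_iff hs n k).1 ⟨h3, h4⟩, rpow_pow_div_zpow_floor hs] at h5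
        exact ⟨n, by omega, h5⟩
      · obtain ⟨N, hN⟩ := pow_unbounded_of_one_lt X ht
        obtain ⟨l, hl, h5⟩ := H N
        obtain ⟨h3, h4⟩ := (zpow_bracket_iff (r := r) hs l ⌊r * l⌋).2 rfl
        refine ⟨s ^ ⌊r * l⌋, (s ^ r) ^ l, ⟨_, rfl⟩, ⟨l, zpow_natCast _ _⟩,
          hN.trans_le (pow_le_pow_right₀ ht.le hl), h3, h4, ?_⟩
        rw [rpow_pow_div_zpow_floor hs]
        exact h5
    constructor
    · rintro ⟨k, hk⟩
      have hy : 1 < y := by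
        rw [← hk]
        simp only
        have : (0 : ℝ) ≤ k := k.cast_nonneg
        linarith
      exact ⟨hy, (key hy).2 ⟨k, hk.symm⟩⟩
    · rintro ⟨hy, h⟩
      obtain ⟨k, hk⟩ := (key hy).1 h
      exact ⟨k, hk.symm⟩
  have h3 : DefRel S fun w : Fin 1 → ℝ => ∃ y z, y ∈ Set.range (fun k : ℕ => (k : ℝ) + 2) ∧
      z ∈ Set.range (fun k : ℕ => (k : ℝ) + 2) ∧ w 0 = y - z :=
    .ex (.ex (.and (h2.mem_unary (.var _)) (.and (h2.mem_unary (.var _))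
      (.eq (.var _) (.sub (.var _) (.var _))))))
  refine h3.congr fun w => ?_
  constructor
  · rintro ⟨k, hk⟩
    refine ⟨_, _, ⟨k.toNat, rfl⟩, ⟨(-k).toNat, rfl⟩, ?_⟩
    have : ((k.toNat : ℤ) : ℝ) - (((-k).toNat : ℤ) : ℝ) = k := by
      rw [← Int.cast_sub, Int.toNat_sub_toNat_neg]
    simp only at *
    push_cast at this
    linarith
  · rintro ⟨_, _, ⟨k, rfl⟩, ⟨l, rfl⟩, hw⟩
    exact ⟨(k : ℤ) - l, by rw [hw]; push_cast; ring⟩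

end

/-! ### The derivative from the powers of `s` and restricted analytic functions -/

section

variable {S : Set RealSet} {s : ℝ}

/-- The value of `x (x F'/F)'` for `x > 0` in terms of the values of the same function on `[0, 1]`
and of the power `p` of `s` with `p ≤ x < s p`. -/
theorem mul_derivMulLogDeriv_eq (hs : 1 < s) {x : ℝ} (hx : 0 < x) (k : ℤ) {p : ℝ}
    (hp : p = s ^ k) :
    x * derivMulLogDeriv s x =
      p / x * derivMulLogDeriv s (p / x) + x / (s * p) * derivMulLogDeriv s (x / (s * p)) +
        x / p / (1 + x / p) ^ 2 + x / (s * p) / (1 + x / (s * p)) ^ 2 -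
        1 / x * derivMulLogDeriv s (1 / x) - x / (1 + x) ^ 2 := by
  have hs0 : 0 < s := by linarith
  have hp0 : 0 < p := by rw [hp]; positivity
  have h1 := add_int_mul_of_quasiperiodic (δ := 0) (θ := periodicPart s)
    (fun u => by rw [periodicPart_add_log hs, add_zero]) k (Real.log x - k * Real.log s)
  rw [sub_add_cancel, mul_zero, add_zero] at h1
  have e1 : Real.exp (Real.log x - k * Real.log s) = x / p := by
    rw [Real.exp_sub, Real.exp_log hx, mul_comm, ← Real.rpow_def_of_pos hs0, Real.rpow_intCast, hp]
  rw [periodicPart, periodicPart, Real.exp_neg, Real.exp_neg, e1, Real.exp_log hx, inv_div] at h1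
  have h2 := derivMulLogDeriv_mul hs (x := x / (s * p))
    (eulerProduct_ne_zero_of_neg_one_lt hs (by
      have : 0 < s * (x / (s * p)) := by positivity
      linarith))
  have e2 : s * (x / (s * p)) = x / p := by field_simp
  rw [e2] at h2
  have h3 : x / p * derivMulLogDeriv s (x / p) =
      x / (s * p) * derivMulLogDeriv s (x / (s * p)) + x / (s * p) / (1 + x / (s * p)) ^ 2 := by
    linear_combination (x / (s * p)) * h2 - derivMulLogDeriv s (x / p) * e2
  rw [one_div]
  linarith

theorem Defines.derivMulLogDeriv_indicator (hs : 1 < s) (hS : restrictedAnalytic ⊆ S) :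
    DefRel S fun v : Fin 2 → ℝ =>
      v 1 = (Set.Icc (-1) 1).indicator (derivMulLogDeriv s) (v 0) := by
  let f : (Fin 1 → ℝ) → ℝ := fun v => derivMulLogDeriv s (v 0)
  have hf : AnalyticOnNhd ℝ f (Set.Icc (-1) 1) := fun v hv => by
    have h : AnalyticAt ℝ (derivMulLogDeriv s) (v 0) :=
      analyticAt_derivMulLogDeriv hs (eulerProduct_ne_zero_of_abs_lt hs
        ((abs_le.2 ⟨hv.1 0, hv.2 0⟩).trans_lt hs))
    exact AnalyticAt.comp (f := fun v : Fin 1 → ℝ => v 0) h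
      ((ContinuousLinearMap.proj (R := ℝ) (φ := fun _ : Fin 1 => ℝ) 0).analyticAt v)
  have h := Defines.of_mem (S := S) (hS ⟨1, f, hf, rfl⟩)
  refine DefRel.congr h fun v => ?_
  have hiff : Fin.init v ∈ Set.Icc (-1 : Fin 1 → ℝ) 1 ↔ v 0 ∈ Set.Icc (-1 : ℝ) 1 := by
    simp [Set.mem_Icc, Pi.le_def, Fin.init]
  change v 1 = (Set.Icc (-1) 1).indicator (derivMulLogDeriv s) (v 0) ↔
    v 1 = (Set.Icc (-1) 1).indicator f (Fin.init v)
  by_cases h0 : v 0 ∈ Set.Icc (-1 : ℝ) 1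
  · rw [Set.indicator_of_mem h0, Set.indicator_of_mem (hiff.2 h0)]
    rfl
  · rw [Set.indicator_of_notMem h0, Set.indicator_of_notMem (mt hiff.1 h0)]

theorem exists_zpow_bracket (hs : 1 < s) {x : ℝ} (hx : 0 < x) :
    ∃ k : ℤ, s ^ k ≤ x ∧ x < s * s ^ k := by
  obtain ⟨k, h1, h2⟩ := exists_mem_Ico_zpow hx hs
  exact ⟨k, h1, by rwa [← zpow_one_add₀ (by linarith), add_comm]⟩

/-- On `(-1, ∞)` there is no pole; the function is given on `(-1, 1]` by a restricted analytic
function, and on `(1, ∞)` by the powers of `s` and the values on `[0, 1]`. -/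
theorem Defines.derivMulLogDerivGraph_of_neg_one_le (hs : 1 < s) (hS : restrictedAnalytic ⊆ S)
    (hpow : Defines S (integerPowers s)) {c : ℝ} (hc : -1 ≤ c) :
    Defines S (derivMulLogDerivGraph s c) := by
  have hs0 : 0 < s := by linarith
  let g : ℝ → ℝ := (Set.Icc (-1) 1).indicator (derivMulLogDeriv s)
  have hg : ∀ {α : Type} {f : (α → ℝ) → ℝ}, DefFun S f → DefFun S fun v => g (f v) :=
    fun hf => hf.of_graph (Defines.derivMulLogDeriv_indicator hs hS)
  have hgeq : ∀ x, -1 ≤ x → x ≤ 1 → g x = derivMulLogDeriv s x := fun x h1 h2 =>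
    Set.indicator_of_mem (show x ∈ Set.Icc (-1) 1 from ⟨h1, h2⟩) _
  have key : DefRel S fun v : Fin 2 → ℝ => c < v 0 ∧ ((v 0 ≤ 1 ∧ v 1 = g (v 0)) ∨
      (1 < v 0 ∧ ∃ p, p ∈ Set.range (fun k : ℤ => s ^ k) ∧ p ≤ v 0 ∧ v 0 < s * p ∧ v 0 * v 1 =
        p / v 0 * g (p / v 0) + v 0 / (s * p) * g (v 0 / (s * p)) +
        v 0 / p / (1 + v 0 / p) ^ 2 + v 0 / (s * p) / (1 + v 0 / (s * p)) ^ 2 -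
        1 / v 0 * g (1 / v 0) - v 0 / (1 + v 0) ^ 2)) := by
    have hdiv : ∀ {α : Type} {f : (α → ℝ) → ℝ}, DefFun S f →
        DefFun S fun v => f v / (1 + f v) ^ 2 := fun hf => .div hf (.pow (.add (.const 1) hf) 2)
    have hmul : ∀ {α : Type} {f : (α → ℝ) → ℝ}, DefFun S f →
        DefFun S fun v => f v * g (f v) := fun hf => .mul hf (hg hf)
    refine .and (.lt (.const c) (.var _)) (.or
      (.and (.le (.var _) (.const 1)) (.eq (.var _) (hg (.var _))))
      (.and (.lt (.const 1) (.var _)) (.ex (.and (hpow.mem_unary (.var _))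
        (.and (.le (.var _) (.var _)) (.and (.lt (.var _) (.mul (.const s) (.var _)))
        (.eq (.mul (.var _) (.var _)) (.sub (.sub (.add (.add (.add (hmul (.div (.var _) (.var _)))
          (hmul (.div (.var _) (.mul (.const s) (.var _))))) (hdiv (.div (.var _) (.var _))))
          (hdiv (.div (.var _) (.mul (.const s) (.var _)))))
          (hmul (.div (.const 1) (.var _)))) (hdiv (.var _))))))))))
  refine key.congr fun v => ?_
  change ((c < v 0 ∧ eulerProduct s (v 0) ≠ 0) ∧ v 1 = derivMulLogDeriv s (v 0)) ↔ _
  generalize v 0 = x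
  generalize v 1 = y
  -- For `x > 1` all arguments of `g` in the formula lie in `[0, 1]`.
  have hform : ∀ k : ℤ, 1 < x → s ^ k ≤ x → x < s * s ^ k →
      (x * y = s ^ k / x * g (s ^ k / x) + x / (s * s ^ k) * g (x / (s * s ^ k)) +
        x / s ^ k / (1 + x / s ^ k) ^ 2 + x / (s * s ^ k) / (1 + x / (s * s ^ k)) ^ 2 -
        1 / x * g (1 / x) - x / (1 + x) ^ 2 ↔ y = derivMulLogDeriv s x) := by
    intro k hx h1 h2
    have hx0 : 0 < x := by linarith
    have hk : 0 < s ^ k := by positivity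
    have b1 : 0 < s ^ k / x := by positivity
    have b2 : 0 < x / (s * s ^ k) := by positivity
    have b3 : 0 < 1 / x := by positivity
    rw [hgeq (s ^ k / x) (by linarith) ((div_le_one hx0).2 h1),
      hgeq (x / (s * s ^ k)) (by linarith) ((div_le_one (by positivity)).2 h2.le),
      hgeq (1 / x) (by linarith) ((div_le_one hx0).2 hx.le),
      ← mul_derivMulLogDeriv_eq hs hx0 k rfl]
    exact mul_right_inj' hx0.ne'
  constructor
  · rintro ⟨⟨h1, h2⟩, h3⟩
    refine ⟨h1, ?_⟩
    rcases le_or_gt x 1 with h | h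
    · exact Or.inl ⟨h, by rw [hgeq x (by linarith) h, h3]⟩
    · obtain ⟨k, hk1, hk2⟩ := exists_zpow_bracket hs (zero_lt_one.trans h)
      exact Or.inr ⟨h, s ^ k, ⟨k, rfl⟩, hk1, hk2, (hform k h hk1 hk2).2 h3⟩
  · rintro ⟨h1, h⟩
    refine ⟨⟨h1, eulerProduct_ne_zero_of_neg_one_lt hs (by linarith)⟩, ?_⟩
    rcases h with ⟨h, h3⟩ | ⟨h, _, ⟨k, rfl⟩, hk1, hk2, h3⟩
    · rw [h3, hgeq x (by linarith) h]
    · exact (hform k h hk1 hk2).1 h3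

/-- The functional equation carries the graph on `(c / s, ∞)` to the graph on `(c, ∞)`, where `-s`
may be a further pole; finitely many such steps lead from `(-1, ∞)` to any given ray. -/
theorem Defines.derivMulLogDerivGraph_of_integerPowers (hs : 1 < s) (hS : restrictedAnalytic ⊆ S)
    (hpow : Defines S (integerPowers s)) (c : ℝ) : Defines S (derivMulLogDerivGraph s c) := by
  have hs0 : 0 < s := by linarith
  have key : ∀ n : ℕ, ∀ c : ℝ, -s ^ n ≤ c → Defines S (derivMulLogDerivGraph s c) := by
    intro n
    induction n with
    | zero =>
      intro c hc
      exact Defines.derivMulLogDerivGraph_of_neg_one_le hs hS hpow (by simpa using hc)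
    | succ n ih =>
      intro c hc
      have h1 := ih (c / s) (by
        rw [le_div_iff₀ hs0, neg_mul, ← pow_succ]
        exact hc)
      have h2 : DefRel S fun v : Fin 2 → ℝ => ¬ 1 + v 0 / s = 0 ∧
          (v 0 / s ∈ rayOffPoles s (c / s) ∧
            s * v 1 - 1 / (1 + v 0 / s) ^ 2 = derivMulLogDeriv s (v 0 / s)) := by
        refine .and (.not (.eq (.add (.const 1) (.div (.var _) (.const s))) (.const 0))) ?_
        exact Defines.mem_graph (f := fun v : Fin 2 → ℝ => v 0 / s)
          (g := fun v => s * v 1 - 1 / (1 + v 0 / s) ^ 2) h1 (.div (.var _) (.const s))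
          (.sub (.mul (.const s) (.var _))
            (.div (.const 1) (.pow (.add (.const 1) (.div (.var _) (.const s))) 2)))
      refine h2.congr fun v => ?_
      change ((c < v 0 ∧ eulerProduct s (v 0) ≠ 0) ∧ v 1 = derivMulLogDeriv s (v 0)) ↔
        ¬ 1 + v 0 / s = 0 ∧ ((c / s < v 0 / s ∧ eulerProduct s (v 0 / s) ≠ 0) ∧ _)
      generalize v 0 = x
      generalize v 1 = y
      have hmul : s * (x / s) = x := by field_simp
      have h3 := eulerProduct_mul hs (x / s)
      have h4 := derivMulLogDeriv_mul hs (x := x / s)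
      rw [hmul] at h3 h4
      have h5 : y = derivMulLogDeriv s x ↔ s * y = s * derivMulLogDeriv s x :=
        (mul_right_inj' hs0.ne').symm
      rw [h5, h3, mul_ne_zero_iff, div_lt_div_iff_of_pos_right hs0]
      constructor
      · rintro ⟨⟨h6, h7, h8⟩, h9⟩
        refine ⟨h7, ⟨h6, h8⟩, ?_⟩
        rw [h9, h4 (by rw [h3]; exact mul_ne_zero h7 h8)]
        ring
      · rintro ⟨h7, ⟨h6, h8⟩, h9⟩
        refine ⟨⟨h6, h7, h8⟩, ?_⟩
        rw [h4 (by rw [h3]; exact mul_ne_zero h7 h8), ← h9]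
        ring
  obtain ⟨n, hn⟩ := pow_unbounded_of_one_lt (-c) hs
  exact key n c (by linarith)

/-- The powers of `s^q`, for a positive rational number `q`, are the positive solutions `x` of
`x^b = y^a` with `y` a power of `s` and `q = a / b`. -/
theorem Defines.integerPowers_rpow (hs : 1 < s) (hpow : Defines S (integerPowers s)) {q : ℚ}
    (hq : 0 < q) : Defines S (integerPowers (s ^ (q : ℝ))) := by
  have hs0 : 0 < s := by linarith
  have hden : (q.den : ℝ) ≠ 0 := by exact_mod_cast q.den_ne_zero
  have hnum : ((q.num.toNat : ℕ) : ℝ) = q.num := by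
    exact_mod_cast Int.toNat_of_nonneg (Rat.num_pos.2 hq).le
  have hqd : (q : ℝ) * q.den = q.num := by exact_mod_cast Rat.mul_den_eq_num q
  have h1 : DefRel S fun v : Fin 1 → ℝ => 0 < v 0 ∧ ∃ y,
      y ∈ Set.range (fun k : ℤ => s ^ k) ∧ v 0 ^ q.den = y ^ q.num.toNat :=
    .and (.lt (.const 0) (.var _)) (.ex (.and (hpow.mem_unary (.var _))
      (.eq (.pow (.var _) _) (.pow (.var _) _))))
  have h2 : ∀ k : ℤ, ((s ^ (q : ℝ)) ^ k) ^ q.den = (s ^ k) ^ q.num.toNat := fun k => by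
    rw [← Real.rpow_intCast, ← Real.rpow_intCast, ← Real.rpow_natCast, ← Real.rpow_natCast,
      ← Real.rpow_mul hs0.le, ← Real.rpow_mul hs0.le, ← Real.rpow_mul hs0.le, hnum, ← hqd]
    congr 1
    ring
  refine h1.congr fun v => ?_
  constructor
  · rintro ⟨k, hk⟩
    rw [← hk]
    exact ⟨by positivity, s ^ k, ⟨k, rfl⟩, h2 k⟩
  · rintro ⟨h0, _, ⟨k, rfl⟩, h3⟩
    refine ⟨k, ?_⟩
    refine (pow_left_inj₀ (by positivity) h0.le q.den_ne_zero).1 ?_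
    rw [h3, ← h2]

end

theorem mainTheorem4 (s c : ℝ) (hs : 1 < s) :
    Defines {logDerivGraph s c} integers ∧
    Defines {derivMulLogDerivGraph s c} (integerPowers s) ∧
    (∀ r : ℝ, 0 < r → Irrational r →
      Defines {derivMulLogDerivGraph s c, derivMulLogDerivGraph (s ^ r) c} integers) ∧
    (∀ q : ℚ, 0 < q →
      Defines (restrictedAnalytic ∪ {integerPowers s})
        (derivMulLogDerivGraph (s ^ (q : ℝ)) c)) := by
  refine ⟨.integers_of_logDerivGraph hs (.of_mem rfl),
    .integerPowers_of_derivMulLogDerivGraph hs (.of_mem rfl), fun r hr0 hr => ?_, fun q hq => ?_⟩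
  · exact .integers_of_integerPowers hs hr0 hr
      (.integerPowers_of_derivMulLogDerivGraph hs (.of_mem (.inl rfl)))
      (.integerPowers_of_derivMulLogDerivGraph (Real.one_lt_rpow hs hr0) (.of_mem (.inr rfl)))
  · exact .derivMulLogDerivGraph_of_integerPowers
      (Real.one_lt_rpow hs (by exact_mod_cast hq)) Set.subset_union_left
      (.integerPowers_rpow hs (.of_mem (.inr rfl)) hq) c
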